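/- Let $G=(V,E)$ be a finite graph, possibly with parallel edges but without loops, let $V=B\sqcup R$ be a partition of its vertex set into two (possibly empty) sets, let $d\ge 3$, $D=\binom{d+1}{2}$ and $W=\mathbb{R}^{d+1}$. For $F\subseteq E$ let $V(F)$ be the set of vertices incident to some edge of $F$, and $R(F)=V(F)\cap R$. Regard the Grassmannian $Gr(d-1,W)$ as a subset of $\mathbb{P}(\bigwedge^{d-1}W)$ by the Plücker embedding. A rod-configuration $\mathbf r$ assigns to the vertices $v\in R$ mutually distinct points $[\mathbf r_v]\in Gr(d-1,W)$. For $p\in\bigwedge^2W$ and $q\in\bigwedge^{d-1}W$ put $\langle p,q\rangle=\sum_{i_1<i_2}(-1)^{i_1+i_2}p_{i_1i_2}\,q_{j_1\dots j_{d-1}}$ in standard coordinates, where $\{j_1<\dots<j_{d-1}\}=\{1,\dots,d+1\}\setminus\{i_1,i_2\}$. Let $H_{\mathbf r}(v)=\{\alpha\in\bigwedge^2W:\langle\alpha,\mathbf r_v\rangle=0\}$ for $v\in R$ and $H_{\mathbf r}(v)=\bigwedge^2W$ for $v\in B$. For an edge $e=uv$ let $A_e(\mathbf r)\subseteq\prod_{w\in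 V}\bigwedge^2W$ be the linear space of all vectors with entry $\alpha$ at $u$, entry $-\alpha$ at $v$ and $0$ elsewhere, where $\alpha\in H_{\mathbf r}(u)\cap H_{\mathbf r}(v)$ (equivalently, a flat of the associated projective space). A property holds for almost all rod-configurations if it holds outside a proper algebraic subset of the configuration space, i.e. if there is a polynomial in the homogeneous Plücker coordinates of the rods that does not vanish identically on the rod-configurations and such that the property holds for every rod-configuration having homogeneous coordinates at which the polynomial does not vanish. Theorem. For almost all rod-configurations $\mathbf r$, $$\dim\Big(\sum_{e\in E}A_e(\mathbf r)\Big)=\min\Big\{\sum_{i=1}^k\big(D|V(E_i)|-D-|R(E_i)|\big)\Big\},$$ where the minimum is over all partitions $\{E_1,\dots,E_k\}$ of $E$ into nonempty subsets (the empty partition, with sum $0$, if $E=\emptyset$). Moreover, for almost all $\mathbf r$ the linear polymatroid of the family $(A_e(\mathbf r))_{e\in E}$ equals the combinatorial polymatroid induced by $f(F)=D|V(F)|-D-|R(F)|$: for every $F\subseteq E$, $\dim\big(\sum_{e\in F}A_e(\mathbf r)\big)$ is the minimum of $\sum_i f(F_i)$ over all partitions $\{F_1,\dots,F_k\}$ of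 $F$ into nonempty subsets. -/

import Mathlib

open scoped LinearAlgebra.Projectivization Graph

noncomputable section

namespace BodyRodBar

/-! ### Plücker coordinates -/

/-- The indices `i₁ < ⋯ < iₖ` of the Plücker coordinates: the `k`-element subsets of `Fin n`. -/
abbrev PluckerIndex (n k : ℕ) : Type := Set.powersetCard (Fin n) k

/-- The exterior power `⋀ᵏ ℝⁿ`, written in coordinates with respect to the standard basis
`e_{i₁} ∧ ⋯ ∧ e_{iₖ}`, `i₁ < ⋯ < iₖ`. -/
abbrev PluckerSpace (n k : ℕ) : Type := PluckerIndex n k → ℝ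

/-- The coordinates of `v₁ ∧ ⋯ ∧ vₖ`, where `v₁, …, vₖ` are the rows of `P`: the maximal minors
of `P`. -/
def pluckerVector {n k : ℕ} (P : Matrix (Fin k) (Fin n) ℝ) : PluckerSpace n k :=
  fun I => (P.submatrix id (Finset.orderEmbOfFin I.1 I.2)).det

/-- The Grassmannian `Gr(k, ℝⁿ)` as a subset of `ℙ(⋀ᵏ ℝⁿ)` by the Plücker embedding: the classes
of the nonzero decomposable vectors (`pluckerVector P ≠ 0` says that the rows of `P` are linearly
independent). -/
def grassmannian (n k : ℕ) : Set (ℙ ℝ (PluckerSpace n k)) :=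
  {x | ∃ (P : Matrix (Fin k) (Fin n) ℝ) (h : pluckerVector P ≠ 0),
    x = Projectivization.mk ℝ (pluckerVector P) h}

/-- The complement of a two-element index set in `Fin (d + 1)`. -/
def complIndex {d : ℕ} (I : PluckerIndex (d + 1) 2) : PluckerIndex (d + 1) (d - 1) :=
  ⟨(I.1)ᶜ, by
    have h : (I.1).card = 2 := I.2
    change ((I.1)ᶜ).card = d - 1
    rw [Finset.card_compl, h, Fintype.card_fin]
    omega⟩

/-- The product `⟨p, q⟩ = ∑_{i₁ < i₂} (-1)^{i₁ + i₂} p_{i₁ i₂} q_{j₁ … j_{d-1}}` of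
`p ∈ ⋀² ℝ^{d+1}` and `q ∈ ⋀^{d-1} ℝ^{d+1}`, where `j₁ < ⋯ < j_{d-1}` is the complement of `i₁, i₂`
(indices are counted from `1`). -/
def pluckerProduct {d : ℕ} (p : PluckerSpace (d + 1) 2) (q : PluckerSpace (d + 1) (d - 1)) : ℝ :=
  ∑ I : PluckerIndex (d + 1) 2, (-1) ^ (∑ i ∈ I.1, ((i : ℕ) + 1)) * p I * q (complIndex I)

/-- The hyperplane of `⋀² ℝ^{d+1}` dual to a point of `ℙ(⋀^{d-1} ℝ^{d+1})`. -/
def dualHyperplane {d : ℕ} (x : ℙ ℝ (PluckerSpace (d + 1) (d - 1))) :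
    Submodule ℝ (PluckerSpace (d + 1) 2) where
  carrier := {α | pluckerProduct α x.rep = 0}
  zero_mem' := by simp [pluckerProduct]
  add_mem' := by
    intro a b ha hb
    change pluckerProduct (a + b) x.rep = 0
    have h : pluckerProduct (a + b) x.rep = pluckerProduct a x.rep + pluckerProduct b x.rep := by
      unfold pluckerProduct
      rw [← Finset.sum_add_distrib]
      exact Finset.sum_congr rfl fun I _ => by rw [Pi.add_apply]; ring
    rw [h, show pluckerProduct a x.rep = 0 from ha, show pluckerProduct b x.rep = 0 from hb,
      add_zero]
  smul_mem' := by
    intro c a ha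
    change pluckerProduct (c • a) x.rep = 0
    have h : pluckerProduct (c • a) x.rep = c * pluckerProduct a x.rep := by
      unfold pluckerProduct
      rw [Finset.mul_sum]
      exact Finset.sum_congr rfl fun I _ => by rw [Pi.smul_apply, smul_eq_mul]; ring
    rw [h, show pluckerProduct a x.rep = 0 from ha, mul_zero]

/-! ### Rod-configurations and the flats of the edges -/

variable {V E : Type*}

/-- A rod-configuration assigns to the elements of `R` mutually distinct points of
`Gr(d - 1, ℝ^{d+1})`. -/
structure RodConfiguration (d : ℕ) (R : Set V) where
  rod : R → ℙ ℝ (PluckerSpace (d + 1) (d - 1))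
  mem_grassmannian : ∀ v, rod v ∈ grassmannian (d + 1) (d - 1)
  injective : Function.Injective rod

namespace RodConfiguration

variable {d : ℕ} {R : Set V}

/-- `c` is a system of homogeneous (Plücker) coordinates of the rod-configuration `r`. -/
def IsCoordinates (r : RodConfiguration d R) (c : R → PluckerSpace (d + 1) (d - 1)) : Prop :=
  ∀ v, ∃ h : c v ≠ 0, Projectivization.mk ℝ (c v) h = r.rod v

/-- A property holds for almost all rod-configurations if it holds outside a proper algebraic
subset of the configuration space: there is a polynomial in the Plücker coordinates of the rods
which does not vanish identically on the configuration space, such that the property holds wherever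
this polynomial does not vanish. (The configuration space is open in a product of Grassmannians,
which is an irreducible variety, so a proper algebraic subset has lower dimension.) -/
def AlmostAll (p : RodConfiguration d R → Prop) : Prop :=
  ∃ Q : MvPolynomial (R × PluckerIndex (d + 1) (d - 1)) ℝ,
    (∃ (r : RodConfiguration d R) (c : R → PluckerSpace (d + 1) (d - 1)),
      r.IsCoordinates c ∧ MvPolynomial.eval (fun i => c i.1 i.2) Q ≠ 0) ∧
    ∀ (r : RodConfiguration d R) (c : R → PluckerSpace (d + 1) (d - 1)),
      r.IsCoordinates c → MvPolynomial.eval (fun i => c i.1 i.2) Q ≠ 0 → p r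

/-- `H_r(v)`: the hyperplane dual to the rod of `v` if `v ∈ R`, and the whole space `⋀² ℝ^{d+1}`
if `v ∉ R`. -/
def hyperplane (r : RodConfiguration d R) (v : V) : Submodule ℝ (PluckerSpace (d + 1) 2) :=
  ⨅ h : v ∈ R, dualHyperplane (r.rod ⟨v, h⟩)

open Classical in
/-- The linear space of the flat `A_e(r)` of an edge `e` with ends `u` and `v`: all vectors with
entry `α` at `u`, entry `-α` at `v` and `0` elsewhere, for `α ∈ H_r(u) ∩ H_r(v)`. (Interchanging
`u` and `v` gives the same space, so the supremum only chooses the ends of `e`.) -/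
def edgeFlat (G : Graph V E) (r : RodConfiguration d R) (e : E) :
    Submodule ℝ (V → PluckerSpace (d + 1) 2) :=
  ⨆ (u : V) (v : V) (_ : G.IsLink e u v),
    (r.hyperplane u ⊓ r.hyperplane v).map
      (LinearMap.single ℝ (fun _ : V => PluckerSpace (d + 1) 2) u -
        LinearMap.single ℝ (fun _ : V => PluckerSpace (d + 1) 2) v)

/-- The rank function of the linear polymatroid of the flat family `A(r)`: the rank of the span
of the flats `A_e(r)`, `e ∈ F`. -/
def rank (G : Graph V E) (r : RodConfiguration d R) (F : Finset E) : ℕ :=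
  Module.finrank ℝ (⨆ e ∈ F, r.edgeFlat G e : Submodule ℝ (V → PluckerSpace (d + 1) 2))

end RodConfiguration

/-! ### The combinatorial polymatroid -/

/-- `V(F)`: the vertices spanned by `F`, i.e. incident to some edge of `F`. -/
def spanned (G : Graph V E) (F : Finset E) : Set V := {v | ∃ e ∈ F, G.Inc e v}

/-- `f(F) = D |V(F)| - D - |R(F)|` with `D = (d+1 choose 2)`. -/
def count (d : ℕ) (G : Graph V E) (R : Set V) (F : Finset E) : ℤ :=
  ((d + 1).choose 2 : ℤ) * ((spanned G F).ncard : ℤ) - ((d + 1).choose 2 : ℤ)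
    - ((spanned G F ∩ R).ncard : ℤ)

/-- The rank function of the combinatorial polymatroid: the minimum of `∑ᵢ f(Fᵢ)` over all
partitions `{F₁, …, Fₖ}` of `F` into nonempty subsets. -/
def countHat [DecidableEq E] (d : ℕ) (G : Graph V E) (R : Set V) (F : Finset E) : ℤ :=
  (Finset.univ : Finset (Finpartition F)).inf' Finset.univ_nonempty
    fun P => ∑ X ∈ P.parts, count d G R X

end BodyRodBar

end

/-! Write `D` for the dimension of `⋀² ℝ^{d+1}`. To a vertex set `X` attach its block space: vectors
supported on `X`, with entries in the hyperplanes of the vertices and total zero. An edge flat is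
the block space of the two ends. Distinct rods have distinct hyperplanes, so two hyperplanes always
span everything and, for `2 ≤ X.card`, the block space has dimension `D|X| - D - |X ∩ R|`; thus
`f(F)` is the dimension of the block space of `V(F)`.

The upper bound (`rank_le_countHat`) holds for every rod-configuration: for any partition of `F`,
the flats of a part lie in the block space of its vertex set.

Equality requires a partition in which each part spans its whole block space and the resulting
spaces are independent (`HasComponents`). It is built by induction on the number of nonempty blocks.
If the block spaces satisfy no linear relation, the partition is discrete. Otherwise at least two
blocks must span the block space of their union (`IsCollapsible`); these are replaced by their
union.

To find collapsible blocks, shrink the family to a minimal one with a nonzero relation. By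
minimality a relation is determined by any one of its entries, so the relations have dimension at
most `D`. Counting dimensions with `D ≥ 5`, which follows from `d ≥ 3`, gives a vertex `v` in at
most two blocks, hence in exactly two, `F i` and `F j`. If these share another vertex or `v` carries
no rod, they collapse at once. Otherwise replace them by `(F i ∪ F j) \ {v}`: the relations of the
family are the relations after merging that satisfy one more linear condition, imposed by the
hyperplane at `v`.

Genericity enters only here (`exists_mem_relations_mergeAt`). If the extra condition were vacuous,
moving the rod of `v` would make it effective and lower the dimension of the relations, which is
already minimal. So some relation `z` of the merged family violates the condition. The components of
the merged family exist by induction, and `z` is exactly the extra vector that makes the component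
of the merged block, together with `v`, the span of the original blocks.

The configurations used are those minimizing the dimensions of all relation spaces. They contain a
nonempty Zariski open set, because kernel dimensions are upper semicontinuous and decomposable
vectors are parametrized by polynomials. -/

noncomputable section

set_option linter.unusedSectionVars false

namespace BodyRodBar

/-! ### Dimension formulas -/

section LinearAlgebra

variable {K : Type*} [Field K] {ι M N : Type*} [AddCommGroup M] [Module K M]
  [AddCommGroup N] [Module K N]

/-- Rank–nullity for the restriction of a linear map to a submodule. -/
theorem finrank_map_add_finrank_inf_ker [FiniteDimensional K M] (f : M →ₗ[K] N)
    (p : Submodule K M) :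
    Module.finrank K (p.map f) + Module.finrank K (p ⊓ LinearMap.ker f : Submodule K M) =
      Module.finrank K p := by
  have h := LinearMap.finrank_range_add_finrank_ker (f.domRestrict p)
  have h1 : LinearMap.range (f.domRestrict p) = p.map f := by
    ext x; simp [LinearMap.domRestrict]
  have h2 : (LinearMap.ker (f.domRestrict p)).map p.subtype = p ⊓ LinearMap.ker f := by
    ext x; simp [LinearMap.domRestrict, and_comm]
  rw [h1] at h
  rw [← h2, Submodule.finrank_map_subtype_eq, h]

/-- The dimension of a product of submodules. -/
theorem finrank_pi_univ [Fintype ι] [FiniteDimensional K M] (p : ι → Submodule K M) :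
    Module.finrank K (Submodule.pi Set.univ p : Submodule K (ι → M)) =
      ∑ i, Module.finrank K (p i) := by
  let e : (Submodule.pi Set.univ p : Submodule K (ι → M)) ≃ₗ[K] ((i : ι) → p i) :=
    { toFun := fun x i => ⟨x.1 i, x.2 i (Set.mem_univ i)⟩
      invFun := fun y => ⟨fun i => (y i).1, fun i _ => (y i).2⟩
      map_add' := fun _ _ => rfl
      map_smul' := fun _ _ => rfl
      left_inv := fun _ => rfl
      right_inv := fun _ => rfl }
  rw [e.finrank_eq, Module.finrank_pi_fintype]

theorem finrank_le_of_injOn [FiniteDimensional K N] (f : M →ₗ[K] N) {p : Submodule K M}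
    {q : Submodule K N} (hf : ∀ x ∈ p, f x ∈ q) (hinj : Set.InjOn f p) :
    Module.finrank K p ≤ Module.finrank K q :=
  LinearMap.finrank_le_finrank_of_injective (f := f.restrict hf) fun a b hab =>
    Subtype.ext (hinj a.2 b.2 (congrArg Subtype.val hab))

/-- The sum of the entries of a vector. -/
def total (K ι M : Type*) [Field K] [Fintype ι] [AddCommGroup M] [Module K M] :
    (ι → M) →ₗ[K] M :=
  ∑ i, LinearMap.proj i

@[simp]
theorem total_apply [Fintype ι] (x : ι → M) : total K ι M x = ∑ i, x i := by
  simp [total]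

end LinearAlgebra

/-! ### Blocks

A block is a finite set `X` of vertices. Its space consists of the vectors supported on `X`, with
entries in the hyperplanes `ker (φ v)` and with entries summing up to zero. -/

section Blocks

variable {K : Type*} [Field K] {V ι M : Type*} [Fintype V] [DecidableEq V]
  [AddCommGroup M] [Module K M]

/-- The vectors supported on `X` with entries in the hyperplanes `ker (φ v)`. -/
def sectionSpace (φ : V → Module.Dual K M) (X : Finset V) : Submodule K (V → M) :=
  Submodule.pi Set.univ fun v => if v ∈ X then LinearMap.ker (φ v) else ⊥

/-- The vectors supported on `X` with entries in the hyperplanes `ker (φ v)` and total zero. -/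
def blockSpace (φ : V → Module.Dual K M) (X : Finset V) : Submodule K (V → M) :=
  sectionSpace φ X ⊓ LinearMap.ker (total K V M)

/-- The sum of the hyperplanes `ker (φ v)`, `v ∈ X`. -/
def sumSpace (φ : V → Module.Dual K M) (X : Finset V) : Submodule K M :=
  (sectionSpace φ X).map (total K V M)

variable {φ : V → Module.Dual K M} {X Y : Finset V} {x : V → M}

theorem mem_sectionSpace :
    x ∈ sectionSpace φ X ↔ (∀ v, v ∉ X → x v = 0) ∧ ∀ v, φ v (x v) = 0 := by
  simp only [sectionSpace, Submodule.mem_pi, Set.mem_univ, true_imp_iff]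
  constructor
  · intro h
    refine ⟨fun v hv => by simpa [hv] using h v, fun v => ?_⟩
    by_cases hv : v ∈ X
    · simpa [hv] using h v
    · have : x v = 0 := by simpa [hv] using h v
      rw [this, map_zero]
  · rintro ⟨h1, h2⟩ v
    by_cases hv : v ∈ X
    · simpa [hv] using h2 v
    · simpa [hv] using h1 v hv

theorem mem_blockSpace :
    x ∈ blockSpace φ X ↔ (∀ v, v ∉ X → x v = 0) ∧ (∀ v, φ v (x v) = 0) ∧ ∑ v, x v = 0 := by
  rw [blockSpace, Submodule.mem_inf, mem_sectionSpace, LinearMap.mem_ker, total_apply, and_assoc]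

theorem mem_sumSpace {m : M} :
    m ∈ sumSpace φ X ↔ ∃ z ∈ sectionSpace φ X, ∑ v, z v = m := by
  simp [sumSpace]

theorem sectionSpace_mono (h : X ⊆ Y) : sectionSpace φ X ≤ sectionSpace φ Y := by
  intro x hx
  rw [mem_sectionSpace] at hx ⊢
  exact ⟨fun v hv => hx.1 v fun hv' => hv (h hv'), hx.2⟩

theorem blockSpace_mono (h : X ⊆ Y) : blockSpace φ X ≤ blockSpace φ Y :=
  inf_le_inf_right _ (sectionSpace_mono h)

theorem single_mem_sectionSpace {v : V} (hv : v ∈ X) {m : M} (hm : φ v m = 0) :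
    Pi.single v m ∈ sectionSpace φ X := by
  rw [mem_sectionSpace]
  refine ⟨fun w hw => Pi.single_eq_of_ne (by rintro rfl; exact hw hv) _, fun w => ?_⟩
  by_cases h : w = v
  · subst h; simpa using hm
  · simp [Pi.single_eq_of_ne h]

theorem ker_le_sumSpace {v : V} (hv : v ∈ X) : LinearMap.ker (φ v) ≤ sumSpace φ X := by
  intro m hm
  exact mem_sumSpace.2 ⟨Pi.single v m, single_mem_sectionSpace hv hm, by simp⟩

theorem sumSpace_union_le : sumSpace φ (X ∪ Y) ≤ sumSpace φ X ⊔ sumSpace φ Y := by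
  intro m hm
  obtain ⟨z, hz, rfl⟩ := mem_sumSpace.1 hm
  have : ∀ v, z v ∈ sumSpace φ X ⊔ sumSpace φ Y := by
    intro v
    rw [mem_sectionSpace] at hz
    by_cases h1 : v ∈ X
    · exact Submodule.mem_sup_left (ker_le_sumSpace h1 (hz.2 v))
    · by_cases h2 : v ∈ Y
      · exact Submodule.mem_sup_right (ker_le_sumSpace h2 (hz.2 v))
      · rw [hz.1 v (by simp [h1, h2])]; exact zero_mem _
  exact Submodule.sum_mem _ fun v _ => this v

theorem blockSpace_eq_bot (h : X.card ≤ 1) : blockSpace φ X = ⊥ := by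
  rw [eq_bot_iff]
  intro x hx
  rw [mem_blockSpace] at hx
  rw [Submodule.mem_bot]
  funext v
  by_cases hv : v ∈ X
  · have := hx.2.2
    rwa [Finset.sum_eq_single v (fun w _ hw => hx.1 w fun hw' =>
      hw (Finset.card_le_one.1 h w hw' v hv)) (by simp)] at this
  · exact hx.1 v hv

/-- A vector with total zero supported on `X ∪ Y` decomposes along `X` and `Y` if the hyperplanes
of `X ∩ Y` span the whole space. -/
theorem blockSpace_union_le (h : sumSpace φ (X ∩ Y) = ⊤) :
    blockSpace φ (X ∪ Y) ≤ blockSpace φ X ⊔ blockSpace φ Y := by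
  intro x hx
  rw [mem_blockSpace] at hx
  obtain ⟨hx1, hx2, hx3⟩ := hx
  -- The part of `x` on `X` need not have total zero; `z`, supported on `X ∩ Y`, corrects it and is
  -- given back on the `Y` side.
  obtain ⟨z, hz, hzs⟩ := mem_sumSpace.1 (show (∑ v, if v ∈ X then x v else 0) ∈
    sumSpace φ (X ∩ Y) by rw [h]; trivial)
  rw [mem_sectionSpace] at hz
  have hz1 : ∀ v, v ∉ X → z v = 0 := fun v hv => hz.1 v (by simp [hv])
  have hz2 : ∀ v, v ∉ Y → z v = 0 := fun v hv => hz.1 v (by simp [hv])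
  let a : V → M := fun v => (if v ∈ X then x v else 0) - z v
  have ha : ∑ v, a v = 0 := by simp only [a, Finset.sum_sub_distrib, hzs, sub_self]
  have hφ : ∀ v, φ v (a v) = 0 := by
    intro v
    by_cases hv : v ∈ X <;> simp [a, hv, hx2, hz.2]
  refine Submodule.mem_sup.2 ⟨a, mem_blockSpace.2 ⟨fun v hv => by simp [a, hv, hz1], hφ, ha⟩,
    x - a, mem_blockSpace.2 ⟨fun v hv => ?_, fun v => ?_, ?_⟩, by abel⟩
  · by_cases hv' : v ∈ X
    · simp [a, hv', hz2 v hv]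
    · simp [a, hv', hz2 v hv, hx1 v (by simp [hv, hv'])]
  · simp [hx2, hφ]
  · simp [Finset.sum_sub_distrib, hx3, ha]

variable [FiniteDimensional K M]

theorem finrank_sectionSpace (φ : V → Module.Dual K M) (X : Finset V) :
    Module.finrank K (sectionSpace φ X) = ∑ v ∈ X, Module.finrank K (LinearMap.ker (φ v)) := by
  rw [sectionSpace, finrank_pi_univ, ← Finset.sum_filter_add_sum_filter_not _ (· ∈ X)]
  rw [Finset.sum_congr (g := fun v => Module.finrank K (LinearMap.ker (φ v)))
    (s₂ := X) (by ext; simp), Finset.sum_eq_zero (s := Finset.univ.filter (· ∉ X)), add_zero]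
  · intro v hv
    rw [if_neg (by simpa using hv), finrank_bot]
  · intro v hv
    rw [if_pos hv]

/-- Rank–nullity for the total: the condition that the entries sum to zero costs the full dimension
of `M` exactly when the hyperplanes span. This is the source of the term `-D` in the count. -/
theorem finrank_blockSpace (h : sumSpace φ X = ⊤) :
    Module.finrank K (blockSpace φ X) + Module.finrank K M =
      ∑ v ∈ X, Module.finrank K (LinearMap.ker (φ v)) := by
  rw [← finrank_sectionSpace, ← finrank_map_add_finrank_inf_ker (total K V M) (sectionSpace φ X),
    add_comm, ← finrank_top K M, ← h]
  rfl

end Blocks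

/-! ### Linear relations between the spaces of a family of blocks -/

section Relations

variable {K : Type*} [Field K] {V ι M : Type*} [Fintype V] [DecidableEq V] [Fintype ι]
  [AddCommGroup M] [Module K M]

/-- The linear relations between the spaces of the blocks `F i`. -/
def relations (φ : V → Module.Dual K M) (F : ι → Finset V) : Submodule K (ι → V → M) :=
  Submodule.pi Set.univ (fun i => blockSpace φ (F i)) ⊓ LinearMap.ker (total K ι (V → M))

variable {φ : V → Module.Dual K M} {F : ι → Finset V} {y : ι → V → M}

theorem mem_relations :
    y ∈ relations φ F ↔ (∀ i, y i ∈ blockSpace φ (F i)) ∧ ∑ i, y i = 0 := by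
  simp [relations, Submodule.mem_pi]

/-- The relations do not depend on the hyperplanes of vertices outside of the blocks. -/
theorem relations_congr {φ' : V → Module.Dual K M}
    (h : ∀ i, ∀ v ∈ F i, φ v = φ' v) : relations φ F ≤ relations φ' F := by
  intro y hy
  rw [mem_relations] at hy ⊢
  refine ⟨fun i => ?_, hy.2⟩
  have hi := mem_blockSpace.1 (hy.1 i)
  refine mem_blockSpace.2 ⟨hi.1, fun v => ?_, hi.2.2⟩
  by_cases hv : v ∈ F i
  · rw [← h i v hv]; exact hi.2.1 v
  · rw [hi.1 v hv, map_zero]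

/-- The summation map on the product of the block spaces has the relations as kernel and the span as
image. -/
theorem finrank_relations_add [FiniteDimensional K M] (φ : V → Module.Dual K M)
    (F : ι → Finset V) :
    Module.finrank K (relations φ F) +
        Module.finrank K (⨆ i, blockSpace φ (F i) : Submodule K (V → M)) =
      ∑ i, Module.finrank K (blockSpace φ (F i)) := by
  classical
  rw [← finrank_pi_univ, ← finrank_map_add_finrank_inf_ker (total K ι (V → M))
    (Submodule.pi Set.univ fun i => blockSpace φ (F i)), add_comm]
  congr 1
  rw [show (⨆ i, blockSpace φ (F i)) = (Submodule.pi Set.univ fun i => blockSpace φ (F i)).map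
    (total K ι (V → M)) from ?_]
  apply le_antisymm
  · refine iSup_le fun i x hx => ⟨Pi.single i x, ?_, by simp⟩
    intro j _
    by_cases h : j = i
    · subst h; simpa using hx
    · simp [Pi.single_eq_of_ne h]
  · rintro _ ⟨y, hy, rfl⟩
    rw [total_apply]
    exact Submodule.sum_mem _ fun i _ =>
      le_iSup (fun i => blockSpace φ (F i)) i (hy i (Set.mem_univ i))

/-- The vector that agrees with `x` on `X \ {v}`, vanishes outside of `X`, and has total zero. -/
def closeAt (K : Type*) {V M : Type*} [Field K] [Fintype V] [DecidableEq V] [AddCommGroup M]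
    [Module K M] (X : Finset V) (v : V) : (V → M) →ₗ[K] (V → M) :=
  let r : (V → M) →ₗ[K] (V → M) :=
    LinearMap.pi fun w => if w ∈ X.erase v then LinearMap.proj w else 0
  r - LinearMap.single K (fun _ => M) v ∘ₗ total K V M ∘ₗ r

theorem closeAt_apply (X : Finset V) (v : V) (x : V → M) (w : V) :
    closeAt K X v x w = (if w ∈ X.erase v then x w else 0) -
      Pi.single (M := fun _ => M) v (∑ u ∈ X.erase v, x u) w := by
  have h : ∀ u : V, (if u ∈ X.erase v then LinearMap.proj u else 0 : (V → M) →ₗ[K] M) x =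
      if u ∈ X.erase v then x u else 0 := by
    intro u; split_ifs <;> rfl
  simp only [closeAt, LinearMap.sub_apply, LinearMap.comp_apply, total_apply, LinearMap.pi_apply,
    Pi.sub_apply, h, LinearMap.coe_single, Finset.sum_ite_mem, Finset.univ_inter]

theorem closeAt_self (X : Finset V) (v : V) (x : V → M) :
    closeAt K X v x v = -∑ u ∈ X.erase v, x u := by
  simp [closeAt_apply]

theorem closeAt_of_ne (X : Finset V) {v w : V} (h : w ≠ v) (x : V → M) :
    closeAt K X v x w = if w ∈ X then x w else 0 := by
  simp [closeAt_apply, h]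

theorem sum_closeAt (X : Finset V) (v : V) (x : V → M) : ∑ w, closeAt K X v x w = 0 := by
  simp [closeAt_apply, Finset.sum_sub_distrib, -Finset.mem_erase]

theorem closeAt_mem {X : Finset V} {v : V} (hv : v ∈ X) {x : V → M}
    (hx : ∀ w, w ≠ v → φ w (x w) = 0) (h : φ v (∑ u ∈ X.erase v, x u) = 0) :
    closeAt K X v x ∈ blockSpace φ X := by
  refine mem_blockSpace.2 ⟨fun w hw => ?_, fun w => ?_, sum_closeAt X v x⟩
  · rw [closeAt_of_ne X (by rintro rfl; exact hw hv), if_neg hw]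
  · by_cases hw : w = v
    · subst hw; rw [closeAt_self, map_neg, h, neg_zero]
    · rw [closeAt_of_ne X hw]
      split_ifs
      · exact hx w hw
      · exact map_zero _

/-- A vector is recovered from its entries at the vertices different from `v`. -/
theorem closeAt_eq {X : Finset V} {v : V} {x z : V → M} (hx : x ∈ blockSpace φ X)
    (h : ∀ w ∈ X.erase v, z w = x w) : closeAt K X v z = x := by
  rw [mem_blockSpace] at hx
  have h1 : ∀ w, w ≠ v → closeAt K X v z w = x w := by
    intro w hw
    rw [closeAt_of_ne X hw]
    split_ifs with hwX
    · exact h w (by simp [hw, hwX])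
    · exact (hx.1 w hwX).symm
  funext w
  by_cases hw : w = v
  · subst hw
    have h2 := sum_closeAt (K := K) X w z
    rw [← hx.2.2, ← Finset.add_sum_erase _ _ (Finset.mem_univ w),
      ← Finset.add_sum_erase _ x (Finset.mem_univ w),
      Finset.sum_congr rfl fun u hu => h1 u (Finset.ne_of_mem_erase hu)] at h2
    exact add_right_cancel h2
  · exact h1 w hw

/-- If `X ∩ Y = {v}`, a vector with total zero supported on `(X ∪ Y) \ {v}` is the sum of vectors
supported on `X` and on `Y`, with opposite entries at `v`. -/
theorem sum_erase_add_sum_erase {X Y : Finset V} {v : V} (h : X ∩ Y = {v}) {x : V → M}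
    (hx : x ∈ blockSpace φ ((X ∪ Y).erase v)) :
    ∑ u ∈ X.erase v, x u + ∑ u ∈ Y.erase v, x u = 0 := by
  rw [mem_blockSpace] at hx
  rw [← Finset.sum_union, ← Finset.erase_union_distrib, ← hx.2.2]
  · exact Finset.sum_subset (Finset.subset_univ _) fun w _ hw => hx.1 w hw
  · rw [Finset.disjoint_left]
    intro w hw hw'
    have : w ∈ X ∩ Y := Finset.mem_inter.2 ⟨Finset.mem_of_mem_erase hw, Finset.mem_of_mem_erase hw'⟩
    rw [h, Finset.mem_singleton] at this
    exact Finset.ne_of_mem_erase hw this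

theorem closeAt_add_closeAt {X Y : Finset V} {v : V} (h : X ∩ Y = {v}) {x : V → M}
    (hx : x ∈ blockSpace φ ((X ∪ Y).erase v)) : closeAt K X v x + closeAt K Y v x = x := by
  have hs := sum_erase_add_sum_erase h hx
  rw [mem_blockSpace] at hx
  funext w
  rw [Pi.add_apply]
  by_cases hw : w = v
  · subst hw
    rw [closeAt_self, closeAt_self, ← neg_add, hs, neg_zero, hx.1 w (by simp)]
  · rw [closeAt_of_ne X hw, closeAt_of_ne Y hw]
    by_cases h1 : w ∈ X <;> by_cases h2 : w ∈ Y
    · have : w ∈ X ∩ Y := Finset.mem_inter.2 ⟨h1, h2⟩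
      rw [h, Finset.mem_singleton] at this
      exact absurd this hw
    · simp [h1, h2]
    · simp [h1, h2]
    · simp [h1, h2, hx.1 w (by simp [h1, h2])]

/-! ### Merging two blocks that share a single vertex -/

variable [DecidableEq ι]

/-- The family of blocks with `F i` and `F j` replaced by the block `(F i ∪ F j) \ {v}`. -/
def mergeAt (F : ι → Finset V) (i j : ι) (v : V) : ι → Finset V :=
  Function.update (Function.update F i ((F i ∪ F j).erase v)) j ∅

theorem mergeAt_left {i j : ι} (hij : i ≠ j) (v : V) :
    mergeAt F i j v i = (F i ∪ F j).erase v := by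
  simp [mergeAt, hij]

theorem mergeAt_right (i j : ι) (v : V) : mergeAt F i j v j = ∅ := by
  simp [mergeAt]

theorem mergeAt_of_ne {i j l : ι} (hi : l ≠ i) (hj : l ≠ j) (v : V) :
    mergeAt F i j v l = F l := by
  simp [mergeAt, hi, hj]

/-- Adding to the entry at `i`, and subtracting from the entry at `j`, the value of `τ`. -/
def transfer {N : Type*} [AddCommGroup N] [Module K N] (i j : ι) (τ : (ι → N) →ₗ[K] N) :
    (ι → N) →ₗ[K] (ι → N) :=
  LinearMap.id + LinearMap.single K (fun _ => N) i ∘ₗ τ - LinearMap.single K (fun _ => N) j ∘ₗ τ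

section transfer

variable {N : Type*} [AddCommGroup N] [Module K N] {i j : ι} (τ : (ι → N) →ₗ[K] N) (z : ι → N)

theorem transfer_left (hij : i ≠ j) : transfer i j τ z i = z i + τ z := by
  simp [transfer, hij]

theorem transfer_right (hij : i ≠ j) : transfer i j τ z j = z j - τ z := by
  simp [transfer, hij.symm]

theorem transfer_of_ne {l : ι} (hi : l ≠ i) (hj : l ≠ j) : transfer i j τ z l = z l := by
  simp [transfer, hi, hj]

theorem sum_transfer : ∑ l, transfer i j τ z l = ∑ l, z l := by
  simp [transfer, Finset.sum_add_distrib]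

theorem transfer_transfer (hij : i ≠ j) (τ' : (ι → N) →ₗ[K] N)
    (h : τ' (transfer i j τ z) = -τ z) : transfer i j τ' (transfer i j τ z) = z := by
  funext l
  by_cases hi : l = i
  · subst hi; rw [transfer_left _ _ hij, transfer_left _ _ hij, h]; abel
  by_cases hj : l = j
  · subst hj; rw [transfer_right _ _ hij, transfer_right _ _ hij, h]; abel
  rw [transfer_of_ne _ _ hi hj, transfer_of_ne _ _ hi hj]

end transfer

variable {i j : ι} {v : V}

/-- Only the blocks `i` and `j` contain `v`, so in a relation their entries at `v` cancel and `y i +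
y j` lives off `v`. -/
theorem transfer_mem_relations_mergeAt (hij : i ≠ j) (hl : ∀ l, l ≠ i → l ≠ j → v ∉ F l)
    (hy : y ∈ relations φ F) :
    transfer i j (LinearMap.proj (R := K) j) y ∈ relations φ (mergeAt F i j v) := by
  rw [mem_relations] at hy ⊢
  refine ⟨fun l => ?_, by rw [sum_transfer, hy.2]⟩
  by_cases hi : l = i
  · subst hi
    rw [transfer_left _ _ hij, mergeAt_left hij]
    have h := Submodule.add_mem _
      (blockSpace_mono (Finset.subset_union_left (s₂ := F j)) (hy.1 l))
      (blockSpace_mono (Finset.subset_union_right (s₁ := F l)) (hy.1 j))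
    rw [mem_blockSpace] at h
    refine mem_blockSpace.2 ⟨fun w hw => ?_, h.2⟩
    by_cases hwv : w = v
    · subst hwv
      have h0 := congrFun hy.2 w
      rw [Finset.sum_apply, Pi.zero_apply, ← Finset.add_sum_erase _ _ (Finset.mem_univ l),
        ← Finset.add_sum_erase _ _ (Finset.mem_erase.2 ⟨hij.symm, Finset.mem_univ j⟩),
        Finset.sum_eq_zero, add_zero] at h0
      · exact h0
      · intro k hk
        simp only [Finset.mem_erase, Finset.mem_univ, and_true] at hk
        exact (mem_blockSpace.1 (hy.1 k)).1 w (hl k hk.2 hk.1)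
    · exact h.1 w fun hw' => hw (Finset.mem_erase.2 ⟨hwv, hw'⟩)
  by_cases hj : l = j
  · subst hj
    rw [transfer_right _ _ hij, mergeAt_right]
    simp
  · rw [transfer_of_ne _ _ hi hj, mergeAt_of_ne hi hj]
    exact hy.1 l

theorem closeAt_transfer (hij : i ≠ j) (hv : F i ∩ F j = {v}) (hy : y ∈ relations φ F) :
    closeAt K (F j) v (transfer i j (LinearMap.proj (R := K) j) y i) = y j := by
  rw [mem_relations] at hy
  refine closeAt_eq (hy.1 j) fun w hw => ?_
  rw [transfer_left _ _ hij, Pi.add_apply, (mem_blockSpace.1 (hy.1 i)).1 w, zero_add]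
  · rfl
  · intro hw'
    have : w ∈ F i ∩ F j := Finset.mem_inter.2 ⟨hw', Finset.mem_of_mem_erase hw⟩
    rw [hv, Finset.mem_singleton] at this
    exact Finset.ne_of_mem_erase hw this

/-- The entry of `y i` at `v`, lost in the merging, can be read off from the merged relation. A
merged relation therefore lifts only if this sum lies in the hyperplane of `v`. -/
theorem sum_erase_transfer (hij : i ≠ j) (hv : F i ∩ F j = {v}) (hy : y ∈ relations φ F) :
    ∑ w ∈ (F i).erase v, transfer i j (LinearMap.proj (R := K) j) y i w = -y i v := by
  rw [mem_relations] at hy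
  have hi := mem_blockSpace.1 (hy.1 i)
  have h1 : ∑ w ∈ (F i).erase v, transfer i j (LinearMap.proj (R := K) j) y i w =
      ∑ w ∈ (F i).erase v, y i w := by
    refine Finset.sum_congr rfl fun w hw => ?_
    rw [transfer_left _ _ hij, Pi.add_apply, LinearMap.proj_apply,
      (mem_blockSpace.1 (hy.1 j)).1 w, add_zero]
    intro hw'
    have : w ∈ F i ∩ F j := Finset.mem_inter.2 ⟨Finset.mem_of_mem_erase hw, hw'⟩
    rw [hv, Finset.mem_singleton] at this
    exact Finset.ne_of_mem_erase hw this
  have hvi : v ∈ F i := Finset.mem_of_mem_inter_left (hv ▸ Finset.mem_singleton_self v)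
  rw [h1, eq_neg_iff_add_eq_zero, add_comm, Finset.add_sum_erase _ _ hvi, ← hi.2.2]
  exact Finset.sum_subset (Finset.subset_univ _) fun w _ hw => hi.1 w hw

/-- Converse of merging: split `z i` along `F i` and `F j`, and let the zero totals dictate the
entries at `v`. These are opposite to each other, so the single condition `hφ` puts both in the
hyperplane. -/
theorem transfer_mem_relations (hij : i ≠ j) (hv : F i ∩ F j = {v}) {z : ι → V → M}
    (hz : z ∈ relations φ (mergeAt F i j v))
    (hφ : φ v (∑ w ∈ (F i).erase v, z i w) = 0) :
    transfer i j (-(closeAt K (F j) v ∘ₗ LinearMap.proj i)) z ∈ relations φ F := by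
  rw [mem_relations] at hz ⊢
  refine ⟨fun l => ?_, by rw [sum_transfer, hz.2]⟩
  have hzi := hz.1 i
  rw [mergeAt_left hij] at hzi
  have hker := (mem_blockSpace.1 hzi).2.1
  have hsum := sum_erase_add_sum_erase hv hzi
  have hadd := closeAt_add_closeAt hv hzi
  have hvij : v ∈ F i ∩ F j := hv ▸ Finset.mem_singleton_self v
  by_cases hi : l = i
  · subst hi
    rw [transfer_left _ _ hij]
    have : z l + (-(closeAt K (F j) v ∘ₗ LinearMap.proj l)) z = closeAt K (F l) v (z l) := by
      nth_rewrite 1 [← hadd]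
      simp
    rw [this]
    exact closeAt_mem (Finset.mem_of_mem_inter_left hvij) (fun w _ => hker w) hφ
  by_cases hj : l = j
  · subst hj
    have hzl : z l = 0 := by
      have := hz.1 l
      rwa [mergeAt_right, blockSpace_eq_bot (by simp), Submodule.mem_bot] at this
    rw [transfer_right _ _ hij, hzl, zero_sub, LinearMap.neg_apply, neg_neg]
    refine closeAt_mem (Finset.mem_of_mem_inter_right hvij) (fun w _ => hker w) ?_
    change φ v (∑ u ∈ (F l).erase v, z i u) = 0
    rw [add_comm, ← eq_neg_iff_add_eq_zero] at hsum
    rw [hsum, map_neg, hφ, neg_zero]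
  · rw [transfer_of_ne _ _ hi hj]
    have := hz.1 l
    rwa [mergeAt_of_ne hi hj] at this

/-- The hyperplane of any vertex can be moved off any given nonzero vector without decreasing the
dimension of any space of relations. -/
def IsExtremal (ι : Type*) [Fintype ι] (φ : V → Module.Dual K M) : Prop :=
  ∀ v, φ v ≠ 0 → ∀ β : M, β ≠ 0 → ∃ ψ : Module.Dual K M, ψ β ≠ 0 ∧
    ∀ F : ι → Finset V, Module.finrank K (relations φ F) ≤
      Module.finrank K (relations (Function.update φ v ψ) F)

variable [FiniteDimensional K M]

/-- If `v` lies in exactly two blocks `F i` and `F j`, which meet in `v` only, and has a nonzero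
entry in some relation, then the hyperplane of `v` restricts the relations between the blocks
after merging `F i` and `F j`. -/
theorem exists_mem_relations_mergeAt (hφ : IsExtremal ι φ) (hφv : φ v ≠ 0) (hij : i ≠ j)
    (hv : F i ∩ F j = {v}) (hl : ∀ l, l ≠ i → l ≠ j → v ∉ F l) (hy : y ∈ relations φ F)
    (hyv : y i v ≠ 0) :
    ∃ z ∈ relations φ (mergeAt F i j v), φ v (∑ w ∈ (F i).erase v, z i w) ≠ 0 := by
  by_contra! hcon
  obtain ⟨ψ, hψ, hext⟩ := hφ v hφv (y i v) hyv
  set φ' := Function.update φ v ψ with hφ'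
  have hvm : ∀ l, v ∉ mergeAt F i j v l := by
    intro l
    by_cases hi : l = i
    · subst hi; simp [mergeAt_left hij]
    by_cases hj : l = j
    · subst hj; simp [mergeAt_right]
    rw [mergeAt_of_ne hi hj]; exact hl l hi hj
  have hagree : ∀ l, ∀ w ∈ mergeAt F i j v l, φ' w = φ w := by
    intro l w hw
    exact Function.update_of_ne (by rintro rfl; exact hvm l hw) _ _
  let Φ : (ι → V → M) →ₗ[K] (ι → V → M) := transfer i j (LinearMap.proj (R := K) j)
  let Θ : (ι → V → M) →ₗ[K] (ι → V → M) :=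
    transfer i j (-(closeAt K (F j) v ∘ₗ LinearMap.proj i))
  let s : (ι → V → M) →ₗ[K] M :=
    ∑ w ∈ (F i).erase v, LinearMap.proj (R := K) (φ := fun _ : V => M) w ∘ₗ LinearMap.proj i
  have hs : ∀ z, s z = ∑ w ∈ (F i).erase v, z i w := fun z => by simp [s]
  -- If the condition at `v` is vacuous, every merged relation lifts.
  have h1 : Module.finrank K (relations φ (mergeAt F i j v)) ≤
      Module.finrank K (relations φ F) := by
    refine finrank_le_of_injOn Θ (fun z hz => transfer_mem_relations hij hv hz (hcon z hz))
      (Set.LeftInvOn.injOn (f₁' := Φ) fun z hz => transfer_transfer _ _ hij _ ?_)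
    have hzj : z j = 0 := by
      have := (mem_relations.1 hz).1 j
      rwa [mergeAt_right, blockSpace_eq_bot (by simp), Submodule.mem_bot] at this
    rw [LinearMap.proj_apply, transfer_right _ _ hij, hzj, zero_sub]
  -- Once the hyperplane at `v` is moved, relations still merge, but now into the kernel of `ψ ∘ₗ
  -- s`; the merged blocks avoid `v` and do not see the move.
  have h2 : Module.finrank K (relations φ' F) ≤
      Module.finrank K (relations φ (mergeAt F i j v) ⊓
        LinearMap.ker (ψ ∘ₗ s) : Submodule K (ι → V → M)) := by
    refine finrank_le_of_injOn Φ (fun z hz => ⟨relations_congr hagree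
      (transfer_mem_relations_mergeAt hij hl hz), ?_⟩)
      (Set.LeftInvOn.injOn (f₁' := Θ) fun z hz => transfer_transfer _ _ hij _ ?_)
    · change ψ (s (Φ z)) = 0
      rw [hs, sum_erase_transfer hij hv hz, map_neg, neg_eq_zero]
      have := (mem_blockSpace.1 ((mem_relations.1 hz).1 i)).2.1 v
      rwa [hφ', Function.update_self] at this
    · change -(closeAt K (F j) v (Φ z i)) = -z j
      rw [closeAt_transfer hij hv hz]
  -- The inclusion is proper because `Φ y` has `s`-value `-y i v`, which `ψ` does not kill.
  have h3 : Module.finrank K (relations φ (mergeAt F i j v) ⊓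
        LinearMap.ker (ψ ∘ₗ s) : Submodule K (ι → V → M)) <
      Module.finrank K (relations φ (mergeAt F i j v)) := by
    refine Submodule.finrank_lt_finrank_of_lt (lt_of_le_of_ne inf_le_left fun heq => ?_)
    have hmem := transfer_mem_relations_mergeAt hij hl hy
    rw [← heq] at hmem
    have h0 : ψ (s (Φ y)) = 0 := hmem.2
    rw [hs, sum_erase_transfer hij hv hy, map_neg, neg_eq_zero] at h0
    exact hψ h0
  exact absurd (hext F) (by omega)

end Relations

/-! ### The rigid components of a family of blocks -/

section Components

variable {K : Type*} [Field K] {V ι M : Type*} [Fintype V] [DecidableEq V] [Fintype ι]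
  [DecidableEq ι] [AddCommGroup M] [Module K M]
  {φ : V → Module.Dual K M} {F G : ι → Finset V} {X Y : Finset V} {v : V}

/-- The hyperplanes of any two vertices span the whole space. -/
def IsSpread (φ : V → Module.Dual K M) : Prop :=
  ∀ u w, u ≠ w → LinearMap.ker (φ u) ⊔ LinearMap.ker (φ w) = ⊤

theorem IsSpread.sumSpace_eq_top (h : IsSpread φ) (hX : 2 ≤ X.card) : sumSpace φ X = ⊤ := by
  obtain ⟨u, hu, w, hw, huw⟩ := Finset.one_lt_card.1 hX
  exact top_le_iff.1 ((h u w huw).ge.trans (sup_le (ker_le_sumSpace hu) (ker_le_sumSpace hw)))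

theorem sumSpace_eq_top_of_eq_zero (hv : v ∈ X) (h : φ v = 0) : sumSpace φ X = ⊤ :=
  top_le_iff.1 (le_trans (by rw [h, LinearMap.ker_zero]) (ker_le_sumSpace hv))

/-- An entry can be prescribed at `v` as soon as the other hyperplanes of the block can compensate
it in the total. -/
theorem exists_mem_blockSpace_apply_eq {η : M} (hv : v ∈ X) (hη : φ v η = 0)
    (h : η ∈ sumSpace φ (X.erase v)) : ∃ x ∈ blockSpace φ X, x v = η := by
  obtain ⟨z, hz, hzs⟩ := mem_sumSpace.1 h
  have hmem := Submodule.sub_mem _ (single_mem_sectionSpace hv hη)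
    (sectionSpace_mono (Finset.erase_subset v X) hz)
  refine ⟨Pi.single v η - z, ⟨hmem, by simp [hzs]⟩, ?_⟩
  simp [(mem_sectionSpace.1 hz).1 v]

theorem mem_blockSpace_erase {x : V → M} (hx : x ∈ blockSpace φ X) (h : x v = 0) :
    x ∈ blockSpace φ (X.erase v) := by
  rw [mem_blockSpace] at hx ⊢
  refine ⟨fun w hw => ?_, hx.2⟩
  by_cases hwv : w = v
  · rw [hwv, h]
  · exact hx.1 w fun hw' => hw (Finset.mem_erase.2 ⟨hwv, hw'⟩)

theorem sum_mem_sumSpace {x : V → M} (h : ∀ v, φ v (x v) = 0) :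
    ∑ v ∈ X, x v ∈ sumSpace φ X :=
  Submodule.sum_mem _ fun v hv => ker_le_sumSpace hv (h v)

/-- The blocks are empty or have at least two elements. -/
def IsReduced (F : ι → Finset V) : Prop :=
  ∀ i, F i = ∅ ∨ 2 ≤ (F i).card

/-- At least two blocks span a rigid set. -/
def IsCollapsible (φ : V → Module.Dual K M) (F : ι → Finset V) : Prop :=
  ∃ I : Finset ι, 2 ≤ I.card ∧ (∀ i ∈ I, 2 ≤ (F i).card) ∧
    blockSpace φ (I.biUnion F) ≤ ⨆ i ∈ I, blockSpace φ (F i)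

/-- The union of the blocks in a fibre of `c`. -/
def fiberUnion (c : ι → ι) (F : ι → Finset V) (j : ι) : Finset V :=
  (Finset.univ.filter (c · = j)).biUnion F

theorem mem_fiberUnion {c : ι → ι} {j : ι} : v ∈ fiberUnion c F j ↔ ∃ i, c i = j ∧ v ∈ F i := by
  simp [fiberUnion]

/-- The blocks can be partitioned into rigid classes without relations between them. -/
def HasComponents (φ : V → Module.Dual K M) (F : ι → Finset V) : Prop :=
  ∃ c : ι → ι, (∀ j, blockSpace φ (fiberUnion c F j) ≤ ⨆ i, ⨆ _ : c i = j, blockSpace φ (F i)) ∧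
    relations φ (fiberUnion c F) = ⊥

theorem isCollapsible_of_pair {i j : ι} (hij : i ≠ j) (hi : 2 ≤ (F i).card)
    (hj : 2 ≤ (F j).card) (h : sumSpace φ (F i ∩ F j) = ⊤) : IsCollapsible φ F := by
  refine ⟨{i, j}, (Finset.card_pair hij).ge, by simp [hi, hj], ?_⟩
  rw [Finset.biUnion_insert, Finset.singleton_biUnion, Finset.iSup_insert, Finset.iSup_singleton]
  exact blockSpace_union_le h

/-- Collapsibility is inherited from smaller blocks. -/
theorem IsCollapsible.mono (hφ : IsSpread φ) (h : ∀ i, G i ⊆ F i) (hG : IsCollapsible φ G) :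
    IsCollapsible φ F := by
  obtain ⟨I, hI, hcard, hle⟩ := hG
  refine ⟨I, hI, fun i hi => (hcard i hi).trans (Finset.card_le_card (h i)), ?_⟩
  have hle' : blockSpace φ (I.biUnion G) ≤ ⨆ i ∈ I, blockSpace φ (F i) :=
    hle.trans (iSup₂_mono fun i _ => blockSpace_mono (h i))
  -- The larger blocks are glued on one at a time: each `F l` meets what is already spanned in at
  -- least `G l`, which has two vertices and so spanning hyperplanes.
  have key : ∀ J ⊆ I, blockSpace φ (I.biUnion G ∪ J.biUnion F) ≤ ⨆ i ∈ I, blockSpace φ (F i) := by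
    intro J
    induction J using Finset.induction_on with
    | empty => intro _; simpa using hle'
    | insert l J _ ih =>
      intro hJ
      have hl : l ∈ I := hJ (Finset.mem_insert_self l J)
      rw [Finset.biUnion_insert, Finset.union_comm (F l), ← Finset.union_assoc]
      refine (blockSpace_union_le (hφ.sumSpace_eq_top ((hcard l hl).trans
        (Finset.card_le_card ?_)))).trans (sup_le (ih fun i hi => hJ (Finset.mem_insert_of_mem hi))
          (le_iSup₂_of_le l hl le_rfl))
      intro w hw
      exact Finset.mem_inter.2
        ⟨Finset.mem_union_left _ (Finset.mem_biUnion.2 ⟨l, hl, hw⟩), h l hw⟩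
  exact (blockSpace_mono Finset.subset_union_right).trans (key I subset_rfl)

/-- The family obtained by removing `w` from the block `F i`, and the whole block if it has only
two elements. -/
def removeAt (F : ι → Finset V) (i : ι) (w : V) : ι → Finset V :=
  Function.update F i (if 3 ≤ (F i).card then (F i).erase w else ∅)

theorem IsReduced.removeAt (hF : IsReduced F) (i : ι) (w : V) : IsReduced (removeAt F i w) := by
  intro l
  by_cases h : l = i
  · subst h
    rw [BodyRodBar.removeAt, Function.update_self]
    split_ifs with h3
    · right
      have := Finset.pred_card_le_card_erase (s := F l) (a := w)
      omega
    · exact Or.inl rfl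
  · rw [BodyRodBar.removeAt, Function.update_of_ne h]; exact hF l

theorem removeAt_subset (i : ι) (w : V) (l : ι) : removeAt F i w l ⊆ F l := by
  by_cases h : l = i
  · subst h
    rw [removeAt, Function.update_self]
    split_ifs
    · exact Finset.erase_subset _ _
    · exact Finset.empty_subset _
  · rw [removeAt, Function.update_of_ne h]

theorem notMem_removeAt (i : ι) (w : V) : w ∉ removeAt F i w i := by
  rw [removeAt, Function.update_self]
  split_ifs <;> simp

theorem mem_relations_removeAt {i : ι} {w : V} (hw : w ∈ F i) {y : ι → V → M}
    (hy : y ∈ relations φ F) (h : y i w = 0) : y ∈ relations φ (removeAt F i w) := by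
  rw [mem_relations] at hy ⊢
  refine ⟨fun l => ?_, hy.2⟩
  by_cases hl : l = i
  · subst hl
    have h1 := mem_blockSpace_erase (hy.1 l) h
    rw [removeAt, Function.update_self]
    split_ifs with h3
    · exact h1
    -- A vector of a two-element block that vanishes at one end vanishes, so discarding the whole
    -- block loses nothing.
    · rw [blockSpace_eq_bot (by rw [Finset.card_erase_of_mem hw]; omega), Submodule.mem_bot] at h1
      rw [h1]; exact zero_mem _
  · rw [removeAt, Function.update_of_ne hl]; exact hy.1 l

theorem exists_mem_of_relations_ne_bot (h : relations φ F ≠ ⊥) : ∃ i w, w ∈ F i := by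
  by_contra! hcon
  refine h (eq_bot_iff.2 fun y hy => ?_)
  rw [mem_relations] at hy
  rw [Submodule.mem_bot]
  funext i w
  exact (mem_blockSpace.1 (hy.1 i)).1 w (hcon i w)

/-! ### Existence of rigid components -/

variable [FiniteDimensional K M]

/-- Rigid classes have the same span as their blocks, and without relations the dimensions add up.
-/
theorem HasComponents.exists_finrank_iSup_eq (h : HasComponents φ F) :
    ∃ c : ι → ι, Module.finrank K (⨆ i, blockSpace φ (F i) : Submodule K (V → M)) =
      ∑ j, Module.finrank K (blockSpace φ (fiberUnion c F j)) := by
  obtain ⟨c, hc1, hc2⟩ := h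
  have hsup : ⨆ i, blockSpace φ (F i) = ⨆ j, blockSpace φ (fiberUnion c F j) :=
    le_antisymm (iSup_le fun i => le_iSup_of_le (c i) (blockSpace_mono fun v hv =>
      mem_fiberUnion.2 ⟨i, rfl, hv⟩)) (iSup_le fun j => (hc1 j).trans (iSup₂_le fun i _ =>
        le_iSup (fun i => blockSpace φ (F i)) i))
  refine ⟨c, ?_⟩
  rw [← finrank_relations_add, hc2, finrank_bot, zero_add, hsup]

theorem finrank_le_finrank_ker_add_one (f : Module.Dual K M) :
    Module.finrank K M ≤ Module.finrank K (LinearMap.ker f) + 1 := by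
  have h := f.finrank_range_add_finrank_ker
  have h' := Submodule.finrank_le (LinearMap.range f)
  rw [Module.finrank_self] at h'
  omega

/-- If the space of relations is not zero and its dimension is at most the dimension of the
ambient space, then some vertex lies in at most two blocks. -/
theorem exists_card_filter_mem_le_two (hφ : IsSpread φ) (hM : 5 ≤ Module.finrank K M)
    (hF : IsReduced F) (hne : relations φ F ≠ ⊥)
    (hle : Module.finrank K (relations φ F) ≤ Module.finrank K M) :
    ∃ v, (∃ i, v ∈ F i) ∧ (Finset.univ.filter fun i => v ∈ F i).card ≤ 2 := by
  by_contra! hcon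
  obtain ⟨i₀, w₀, hw₀⟩ := exists_mem_of_relations_ne_bot hne
  set D := Module.finrank K M
  let U := Finset.univ.biUnion F
  let S := Finset.univ.filter fun i => F i ≠ ∅
  let r : V → ℕ := fun v => Module.finrank K (LinearMap.ker (φ v))
  let n : V → ℕ := fun v => (Finset.univ.filter fun i => v ∈ F i).card
  have hU : ∀ i, F i ⊆ U := fun i => Finset.subset_biUnion_of_mem F (Finset.mem_univ i)
  have hk : 0 < S.card := Finset.card_pos.2 ⟨i₀, by simp [S, Finset.ne_empty_of_mem hw₀]⟩
  have hcard : ∀ i ∈ S, 2 ≤ (F i).card := fun i hi =>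
    (hF i).resolve_left (Finset.mem_filter.1 hi).2
  have hdouble : ∀ g : V → ℕ, ∑ i ∈ S, ∑ v ∈ F i, g v = ∑ v ∈ U, n v * g v := by
    intro g
    have h1 : ∑ i ∈ S, ∑ v ∈ F i, g v = ∑ i, ∑ v ∈ F i, g v := by
      refine Finset.sum_subset (Finset.subset_univ _) fun i _ hi => ?_
      have : F i = ∅ := by simpa [S] using hi
      rw [this, Finset.sum_empty]
    rw [h1, Finset.sum_comm' (t' := U) (s' := fun v => Finset.univ.filter fun i => v ∈ F i)]
    · simp [n]
    · intro i v
      simp only [Finset.mem_univ, true_and, Finset.mem_filter]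
      exact ⟨fun h => ⟨h, hU i h⟩, fun h => h.1⟩
  have hL : ∑ i, Module.finrank K (blockSpace φ (F i)) + S.card * D = ∑ v ∈ U, n v * r v := by
    rw [← hdouble, ← Finset.sum_subset (Finset.subset_univ S), ← smul_eq_mul, ← Finset.sum_const,
      ← Finset.sum_add_distrib]
    · exact Finset.sum_congr rfl fun i hi =>
        finrank_blockSpace (hφ.sumSpace_eq_top (hcard i hi))
    · intro i _ hi
      have : F i = ∅ := by simpa [S] using hi
      rw [this, blockSpace_eq_bot (by simp), finrank_bot]
  have hrank := finrank_relations_add φ F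
  have hsup : Module.finrank K (⨆ i, blockSpace φ (F i) : Submodule K (V → M)) + D ≤
      ∑ v ∈ U, r v := by
    rw [← finrank_blockSpace (X := U) (hφ.sumSpace_eq_top
      (((hF i₀).resolve_left (Finset.ne_empty_of_mem hw₀)).trans (Finset.card_le_card (hU i₀))))]
    exact Nat.add_le_add_right
      (Submodule.finrank_mono (iSup_le fun i => blockSpace_mono (hU i))) _
  have h3 : 3 * ∑ v ∈ U, r v ≤ ∑ v ∈ U, n v * r v := by
    rw [Finset.mul_sum]
    refine Finset.sum_le_sum fun v hv => Nat.mul_le_mul_right _ (hcon v ?_)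
    obtain ⟨i, -, hi⟩ := Finset.mem_biUnion.1 hv
    exact ⟨i, hi⟩
  have h4 : S.card * (2 * (D - 1)) ≤ ∑ v ∈ U, n v * r v := by
    rw [← hdouble, ← smul_eq_mul, ← Finset.sum_const]
    refine Finset.sum_le_sum fun i hi => (Nat.mul_le_mul_right _ (hcard i hi)).trans ?_
    rw [← smul_eq_mul, ← Finset.sum_const]
    refine Finset.sum_le_sum fun v _ => ?_
    have : D ≤ r v + 1 := finrank_le_finrank_ker_add_one (φ v)
    omega
  -- With `k = S.card` and `L = ∑ n v * r v`, the relations have dimension at least `L - kD - (∑ r v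
  -- - D) ≥ (2/3)L - (k - 1)D ≥ D + k(D - 4)/3`, by `h3` and `h4`. This exceeds `D` because `D ≥ 5`.
  obtain ⟨e, he⟩ : ∃ e, D = e + 5 := ⟨D - 5, by omega⟩
  rw [he] at h4 hL hsup hle
  have h5 : e + 5 - 1 = e + 4 := by omega
  rw [h5] at h4
  nlinarith

/-- Collapsing two blocks that meet in a single vertex. -/
theorem isCollapsible_of_mergeAt (hφ : IsSpread φ) (hext : IsExtremal ι φ) (hF : IsReduced F)
    {i j : ι} (hij : i ≠ j) (hv : F i ∩ F j = {v}) (hφv : φ v ≠ 0)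
    (hl : ∀ l, l ≠ i → l ≠ j → v ∉ F l) {y : ι → V → M} (hy : y ∈ relations φ F)
    (hyv : y i v ≠ 0) (hcomp : HasComponents φ (mergeAt F i j v)) : IsCollapsible φ F := by
  obtain ⟨z, hz, hzv⟩ := exists_mem_relations_mergeAt hext hφv hij hv hl hy hyv
  obtain ⟨c, hc1, hc2⟩ := hcomp
  have hz' := mem_relations.1 hz
  have hvij : v ∈ F i ∩ F j := hv ▸ Finset.mem_singleton_self v
  have hvi := Finset.mem_of_mem_inter_left hvij
  have hvj := Finset.mem_of_mem_inter_right hvij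
  have hci : 2 ≤ (F i).card := (hF i).resolve_left (Finset.ne_empty_of_mem hvi)
  have hcj : 2 ≤ (F j).card := (hF j).resolve_left (Finset.ne_empty_of_mem hvj)
  -- The collapsing blocks: `F i`, `F j` and the other nonempty blocks in the component of the
  -- merged block. The index `j` is added by hand, since after merging it carries the empty block
  -- and may belong to any class.
  let I := insert i (insert j (Finset.univ.filter fun l =>
    c l = c i ∧ l ≠ i ∧ l ≠ j ∧ F l ≠ ∅))
  have hiI : i ∈ I := by simp [I]
  have hjI : j ∈ I := by simp [I]
  let A := ⨆ l ∈ I, blockSpace φ (F l)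
  have hA : ∀ l ∈ I, blockSpace φ (F l) ≤ A := fun l hl => le_iSup₂_of_le l hl le_rfl
  have hother : ∀ l, l ≠ i → c l = c i → blockSpace φ (mergeAt F i j v l) ≤ A := by
    intro l hli hcl
    by_cases hlj : l = j
    · subst hlj
      rw [mergeAt_right, blockSpace_eq_bot (by simp)]; exact bot_le
    · rw [mergeAt_of_ne hli hlj]
      by_cases h0 : F l = ∅
      · rw [h0, blockSpace_eq_bot (by simp)]; exact bot_le
      · exact hA l (by simp [I, hcl, hli, hlj, h0])
  -- The class sums of `z` form a relation between the components, hence vanish. So `z i` is a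
  -- combination of vectors from the other blocks of its class.
  have hsum : ∀ q, ∑ l ∈ Finset.univ.filter (c · = q), z l = 0 := by
    have hmem : (fun q => ∑ l ∈ Finset.univ.filter (c · = q), z l) ∈
        relations φ (fiberUnion c (mergeAt F i j v)) := by
      refine mem_relations.2 ⟨fun q => Submodule.sum_mem _ fun l hl => blockSpace_mono
        (Finset.subset_biUnion_of_mem _ hl) (hz'.1 l), ?_⟩
      rw [← hz'.2]
      exact Finset.sum_fiberwise _ _ _
    rw [hc2, Submodule.mem_bot] at hmem
    exact fun q => congrFun hmem q
  have hziA : z i ∈ A := by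
    have h0 := hsum (c i)
    rw [← Finset.add_sum_erase _ _ (show i ∈ Finset.univ.filter (c · = c i) by simp)] at h0
    rw [eq_neg_of_add_eq_zero_left h0]
    refine Submodule.neg_mem _ (Submodule.sum_mem _ fun l hl => ?_)
    simp only [Finset.mem_erase, Finset.mem_filter, Finset.mem_univ, true_and] at hl
    exact hother l hl.1 hl.2 (hz'.1 l)
  have hzi := hz'.1 i
  rw [mergeAt_left hij] at hzi
  have hmerge : blockSpace φ ((F i ∪ F j).erase v) ≤ A := by
    intro x hx
    -- Chosen so that `x - a • z i` satisfies the condition at `v` and splits along `F i` and `F j`.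
    let a := φ v (∑ w ∈ (F i).erase v, x w) / φ v (∑ w ∈ (F i).erase v, z i w)
    have hx' : x - a • z i ∈ blockSpace φ ((F i ∪ F j).erase v) :=
      Submodule.sub_mem _ hx (Submodule.smul_mem _ a hzi)
    have hker := (mem_blockSpace.1 hx').2.1
    have h0 : φ v (∑ w ∈ (F i).erase v, (x - a • z i) w) = 0 := by
      simp only [Pi.sub_apply, Pi.smul_apply, Finset.sum_sub_distrib, ← Finset.smul_sum, map_sub,
        map_smul, smul_eq_mul, a]
      rw [div_mul_cancel₀ _ hzv, sub_self]
    have h1 := closeAt_mem hvi (fun w _ => hker w) h0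
    have h2 := closeAt_mem hvj (fun w _ => hker w) (by
      have := sum_erase_add_sum_erase hv hx'
      rw [add_comm, ← eq_neg_iff_add_eq_zero] at this
      rw [this, map_neg, h0, neg_zero])
    have h3 : x = closeAt K (F i) v (x - a • z i) + closeAt K (F j) v (x - a • z i) + a • z i := by
      rw [closeAt_add_closeAt hv hx']; abel
    rw [h3]
    exact Submodule.add_mem _ (Submodule.add_mem _ (hA i hiI h1) (hA j hjI h2))
      (Submodule.smul_mem _ a hziA)
  set X := fiberUnion c (mergeAt F i j v) (c i) with hX
  have hXA : blockSpace φ X ≤ A := by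
    refine (hc1 (c i)).trans (iSup₂_le fun l hcl => ?_)
    by_cases hli : l = i
    · rw [hli, mergeAt_left hij]; exact hmerge
    · exact hother l hli hcl
  have hijX : (F i ∪ F j).erase v ⊆ X := by
    rw [← mergeAt_left hij]
    intro w hw
    exact mem_fiberUnion.2 ⟨i, rfl, hw⟩
  have hIX : I.biUnion F ⊆ insert v X := by
    intro w hw
    rw [Finset.mem_insert]
    by_contra! hcon
    obtain ⟨l, hl, hwl⟩ := Finset.mem_biUnion.1 hw
    simp only [I, Finset.mem_insert, Finset.mem_filter, Finset.mem_univ, true_and] at hl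
    rcases hl with rfl | rfl | hl
    · exact hcon.2 (hijX (Finset.mem_erase.2 ⟨hcon.1, Finset.mem_union_left _ hwl⟩))
    · exact hcon.2 (hijX (Finset.mem_erase.2 ⟨hcon.1, Finset.mem_union_right _ hwl⟩))
    · exact hcon.2 (mem_fiberUnion.2 ⟨l, hl.1, by rwa [mergeAt_of_ne hl.2.1 hl.2.2.1]⟩)
  have hsub : ∀ l ∈ I, F l ⊆ insert v X := fun l hl =>
    (Finset.subset_biUnion_of_mem F hl).trans hIX
  refine ⟨I, Finset.one_lt_card.2 ⟨i, hiI, j, hjI, hij⟩, ?_, (blockSpace_mono hIX).trans ?_⟩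
  · intro l hl
    simp only [I, Finset.mem_insert, Finset.mem_filter, Finset.mem_univ, true_and] at hl
    rcases hl with rfl | rfl | hl
    · exact hci
    · exact hcj
    · exact (hF l).resolve_left hl.2.2.2
  intro x hx
  have hηv : φ v (x v) = 0 := (mem_blockSpace.1 hx).2.1 v
  have hker := (mem_blockSpace.1 hzi).2.1
  -- It remains to add `v`: subtracting vectors of the two original blocks must remove the entry `x
  -- v`. That entry is split as `a + b` along the two sides.
  have htop : sumSpace φ ((F i).erase v) ⊔ sumSpace φ ((F j).erase v) = ⊤ := by
    refine top_le_iff.1 (le_trans ?_ sumSpace_union_le)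
    rw [← Finset.erase_union_distrib, hφ.sumSpace_eq_top]
    have h1 := Finset.card_union_add_card_inter (F i) (F j)
    rw [hv, Finset.card_singleton] at h1
    rw [Finset.card_erase_of_mem (Finset.mem_union_left _ hvi)]
    omega
  set β := ∑ w ∈ (F i).erase v, z i w with hβ
  have hβi : β ∈ sumSpace φ ((F i).erase v) := sum_mem_sumSpace hker
  have hβj : β ∈ sumSpace φ ((F j).erase v) := by
    rw [hβ, eq_neg_of_add_eq_zero_left (sum_erase_add_sum_erase hv hzi)]
    exact Submodule.neg_mem _ (sum_mem_sumSpace hker)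
  obtain ⟨a, ha, b, hb, hab⟩ := Submodule.mem_sup.1 (show x v ∈ _ ⊔ _ by rw [htop]; trivial)
  -- Since `β` is available on both sides, the split can be shifted until both summands lie in the
  -- hyperplane of `v`.
  let t := φ v a / φ v β
  have ht : φ v (a - t • β) = 0 := by
    rw [map_sub, map_smul, smul_eq_mul, div_mul_cancel₀ _ hzv, sub_self]
  obtain ⟨x₁, hx₁, hx₁v⟩ := exists_mem_blockSpace_apply_eq hvi ht
    (Submodule.sub_mem _ ha (Submodule.smul_mem _ t hβi))
  obtain ⟨x₂, hx₂, hx₂v⟩ := exists_mem_blockSpace_apply_eq (η := b + t • β) hvj (by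
      have : b + t • β = x v - (a - t • β) := by rw [← hab]; abel
      rw [this, map_sub, hηv, ht, sub_zero])
    (Submodule.add_mem _ hb (Submodule.smul_mem _ t hβj))
  have h1 : x - x₁ - x₂ ∈ blockSpace φ (insert v X) :=
    Submodule.sub_mem _ (Submodule.sub_mem _ hx (blockSpace_mono (hsub i hiI) hx₁))
      (blockSpace_mono (hsub j hjI) hx₂)
  have h2 : x - x₁ - x₂ ∈ A := hXA (blockSpace_mono (Finset.erase_insert_subset v X)
    (mem_blockSpace_erase h1 (by
      rw [Pi.sub_apply, Pi.sub_apply, hx₁v, hx₂v, ← hab]; abel)))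
  have h3 : x = x - x₁ - x₂ + x₁ + x₂ := by abel
  rw [h3]
  exact Submodule.add_mem _ (Submodule.add_mem _ h2 (hA i hiI hx₁)) (hA j hjI hx₂)

/-- The number of nonempty blocks. -/
def blockCount (F : ι → Finset V) : ℕ :=
  (Finset.univ.filter fun i => F i ≠ ∅).card

theorem blockCount_mono (h : ∀ i, F i ⊆ G i) : blockCount F ≤ blockCount G :=
  Finset.card_le_card fun i hi => by
    simp only [Finset.mem_filter, Finset.mem_univ, true_and] at hi ⊢
    exact fun h0 => hi (Finset.subset_empty.1 (h0 ▸ h i))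

theorem blockCount_lt {j : ι} (hj : F j = ∅) (hj' : G j ≠ ∅) (h : ∀ i, G i = ∅ → F i = ∅) :
    blockCount F < blockCount G := by
  refine Finset.card_lt_card ((Finset.ssubset_iff_of_subset fun i hi => ?_).2
    ⟨j, by simp [hj'], by simp [hj]⟩)
  simp only [Finset.mem_filter, Finset.mem_univ, true_and] at hi ⊢
  exact fun h0 => hi (h i h0)

/-- A family of blocks that is minimal among those with a nonzero relation is collapsible. -/
theorem isCollapsible_of_minimal (hφ : IsSpread φ) (hext : IsExtremal ι φ)
    (hM : 5 ≤ Module.finrank K M) (hF : IsReduced F) (hne : relations φ F ≠ ⊥)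
    (hmin : ∀ i, ∀ w ∈ F i, relations φ (removeAt F i w) = ⊥)
    (ih : ∀ G : ι → Finset V, IsReduced G → blockCount G < blockCount F → HasComponents φ G) :
    IsCollapsible φ F := by
  -- Evaluation at one entry is injective: a relation vanishing there would survive the removal of
  -- `w` from block `i`, against minimality.
  have hle : Module.finrank K (relations φ F) ≤ Module.finrank K M := by
    obtain ⟨i, w, hw⟩ := exists_mem_of_relations_ne_bot hne
    rw [← finrank_top K M]
    refine finrank_le_of_injOn (LinearMap.proj w ∘ₗ LinearMap.proj (φ := fun _ : ι => V → M) i)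
      (fun _ _ => Submodule.mem_top) fun y hy y' hy' h => ?_
    have h0 := mem_relations_removeAt hw (Submodule.sub_mem _ hy hy') (sub_eq_zero.2 h)
    rw [hmin i w hw, Submodule.mem_bot] at h0
    exact sub_eq_zero.1 h0
  obtain ⟨v, ⟨i, hi⟩, hdeg⟩ := exists_card_filter_mem_le_two hφ hM hF hne hle
  obtain ⟨y, hy, hyv⟩ : ∃ y ∈ relations φ F, y i v ≠ 0 := by
    by_contra! hcon
    refine hne (eq_bot_iff.2 fun y hy => ?_)
    rw [← hmin i v hi]
    exact mem_relations_removeAt hi hy (hcon y hy)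
  have hy' := mem_relations.1 hy
  obtain ⟨j, hji, hyj⟩ : ∃ j, j ≠ i ∧ y j v ≠ 0 := by
    by_contra! hcon
    have h0 := congrFun hy'.2 v
    rw [Finset.sum_apply, Finset.sum_eq_single i (fun j _ h => hcon j h) (by simp)] at h0
    exact hyv h0
  have hj : v ∈ F j := by
    by_contra h
    exact hyj ((mem_blockSpace.1 (hy'.1 j)).1 v h)
  have hl : ∀ l, l ≠ i → l ≠ j → v ∉ F l := by
    intro l hli hlj hvl
    refine absurd hdeg (not_le.2 (Finset.two_lt_card.2 ⟨i, ?_, j, ?_, l, ?_, hji.symm, hli.symm,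
      hlj.symm⟩)) <;> simpa
  have hci := (hF i).resolve_left (Finset.ne_empty_of_mem hi)
  have hcj := (hF j).resolve_left (Finset.ne_empty_of_mem hj)
  have hvij := Finset.mem_inter.2 ⟨hi, hj⟩
  by_cases hφv : φ v = 0
  · exact isCollapsible_of_pair hji.symm hci hcj (sumSpace_eq_top_of_eq_zero hvij hφv)
  by_cases h2 : 2 ≤ (F i ∩ F j).card
  · exact isCollapsible_of_pair hji.symm hci hcj (hφ.sumSpace_eq_top h2)
  have hv : F i ∩ F j = {v} := by
    refine Finset.eq_singleton_iff_unique_mem.2 ⟨hvij, fun w hw => ?_⟩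
    exact Finset.card_le_one.1 (by omega) w hw v hvij
  refine isCollapsible_of_mergeAt hφ hext hF hji.symm hv hφv hl hy hyv (ih _ ?_ ?_)
  · intro l
    by_cases hli : l = i
    · subst hli
      right
      have h1 := Finset.card_union_add_card_inter (F l) (F j)
      rw [hv, Finset.card_singleton] at h1
      rw [mergeAt_left hji.symm, Finset.card_erase_of_mem (Finset.mem_union_left _ hi)]
      omega
    by_cases hlj : l = j
    · subst hlj; exact Or.inl (mergeAt_right _ _ _)
    · rw [mergeAt_of_ne hli hlj]; exact hF l
  · refine blockCount_lt (mergeAt_right i j v) (Finset.ne_empty_of_mem hj) fun l h0 => ?_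
    by_cases hli : l = i
    · subst hli; simp [h0] at hi
    by_cases hlj : l = j
    · subst hlj; exact mergeAt_right _ _ _
    · rw [mergeAt_of_ne hli hlj, h0]

/-- Shrink the blocks to a reduced subfamily of least total size with a nonzero relation;
collapsibility passes back to the larger blocks. -/
theorem isCollapsible_of_relations_ne_bot (hφ : IsSpread φ) (hext : IsExtremal ι φ)
    (hM : 5 ≤ Module.finrank K M) (hF : IsReduced F) (hne : relations φ F ≠ ⊥)
    (ih : ∀ G : ι → Finset V, IsReduced G → blockCount G < blockCount F → HasComponents φ G) :
    IsCollapsible φ F := by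
  obtain ⟨G, ⟨hGF, hG, hGne⟩, hmin⟩ := Set.exists_min_image
    {G : ι → Finset V | (∀ i, G i ⊆ F i) ∧ IsReduced G ∧ relations φ G ≠ ⊥}
    (fun G => ∑ i, (G i).card) (Set.toFinite _) ⟨F, fun _ => subset_rfl, hF, hne⟩
  refine IsCollapsible.mono hφ hGF (isCollapsible_of_minimal hφ hext hM hG hGne ?_
    fun G' hG' hlt => ih G' hG' (hlt.trans_le (blockCount_mono hGF)))
  intro i w hw
  by_contra hcon
  refine absurd (hmin _ ⟨fun l => (removeAt_subset i w l).trans (hGF l), hG.removeAt i w, hcon⟩)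
    (not_le.2 (Finset.sum_lt_sum (fun l _ => Finset.card_le_card (removeAt_subset i w l))
      ⟨i, Finset.mem_univ i, Finset.card_lt_card ?_⟩))
  exact (Finset.ssubset_iff_of_subset (removeAt_subset i w i)).2 ⟨w, hw, notMem_removeAt i w⟩

/-- A collapsible family has components if all families with fewer blocks have components. -/
theorem hasComponents_of_isCollapsible (hF : IsReduced F) (hc : IsCollapsible φ F)
    (ih : ∀ G : ι → Finset V, IsReduced G → blockCount G < blockCount F → HasComponents φ G) :
    HasComponents φ F := by
  obtain ⟨I, hI, hcard, hle⟩ := hc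
  obtain ⟨i, hi, j, hj, hij⟩ := Finset.one_lt_card.1 hI
  let G : ι → Finset V := fun l => if l = i then I.biUnion F else if l ∈ I then ∅ else F l
  have hGi : G i = I.biUnion F := if_pos rfl
  have hGI : ∀ l, l ≠ i → l ∈ I → G l = ∅ := fun l h1 h2 => by simp [G, h1, h2]
  have hGo : ∀ l, l ∉ I → G l = F l := fun l h => by
    have : l ≠ i := by rintro rfl; exact h hi
    simp [G, this, h]
  obtain ⟨c, hc1, hc2⟩ := ih G (by
    intro l
    by_cases hli : l = i
    · subst hli
      rw [hGi]
      exact Or.inr ((hcard l hi).trans (Finset.card_le_card (Finset.subset_biUnion_of_mem F hi)))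
    by_cases hlI : l ∈ I
    · exact Or.inl (hGI l hli hlI)
    · rw [hGo l hlI]; exact hF l) (by
    have hne : ∀ l ∈ I, F l ≠ ∅ := fun l hl h0 => by
      have := hcard l hl
      simp [h0] at this
    refine blockCount_lt (hGI j hij.symm hj) (hne j hj) fun l h0 => ?_
    have hlI : l ∉ I := fun h => hne l h h0
    rw [hGo l hlI, h0])
  let c' : ι → ι := fun l => if l ∈ I then c i else c l
  have hfib : fiberUnion c' F = fiberUnion c G := by
    funext q
    ext v
    rw [mem_fiberUnion, mem_fiberUnion]
    constructor
    · rintro ⟨l, hl, hv⟩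
      by_cases hlI : l ∈ I
      · exact ⟨i, by simpa [c', hlI] using hl, hGi ▸ Finset.mem_biUnion.2 ⟨l, hlI, hv⟩⟩
      · exact ⟨l, by simpa [c', hlI] using hl, by rwa [hGo l hlI]⟩
    · rintro ⟨l, hl, hv⟩
      by_cases hli : l = i
      · subst hli
        rw [hGi] at hv
        obtain ⟨k, hk, hv⟩ := Finset.mem_biUnion.1 hv
        exact ⟨k, by simpa [c', hk] using hl, hv⟩
      by_cases hlI : l ∈ I
      · simp [hGI l hli hlI] at hv
      · exact ⟨l, by simpa [c', hlI] using hl, by rwa [← hGo l hlI]⟩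
  refine ⟨c', fun q => ?_, by rw [hfib, hc2]⟩
  rw [hfib]
  refine (hc1 q).trans (iSup₂_le fun l hl => ?_)
  by_cases hli : l = i
  · subst hli
    rw [hGi]
    exact hle.trans (iSup₂_le fun k hk => le_iSup₂_of_le k (by simpa [c', hk] using hl) le_rfl)
  by_cases hlI : l ∈ I
  · rw [hGI l hli hlI, blockSpace_eq_bot (by simp)]; exact bot_le
  · rw [hGo l hlI]
    exact le_iSup₂_of_le l (by simpa [c', hlI] using hl) le_rfl

theorem hasComponents_of_relations_eq_bot (h : relations φ F = ⊥) : HasComponents φ F := by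
  have hfib : fiberUnion id F = F := by
    funext j; ext v; simp [mem_fiberUnion]
  refine ⟨id, fun j => ?_, by rw [hfib, h]⟩
  rw [hfib]
  exact le_iSup₂_of_le j rfl le_rfl

/-- The spaces of the blocks decompose along the rigid components, if the ambient space has
dimension at least five. -/
theorem hasComponents (hφ : IsSpread φ) (hext : IsExtremal ι φ) (hM : 5 ≤ Module.finrank K M)
    (F : ι → Finset V) (hF : IsReduced F) : HasComponents φ F := by
  induction hn : blockCount F using Nat.strong_induction_on generalizing F with
  | _ n ih =>
    subst hn
    by_cases hrel : relations φ F = ⊥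
    · exact hasComponents_of_relations_eq_bot hrel
    · have ih' : ∀ G : ι → Finset V, IsReduced G → blockCount G < blockCount F →
          HasComponents φ G := fun G hG hlt => ih _ hlt G hG rfl
      exact hasComponents_of_isCollapsible hF
        (isCollapsible_of_relations_ne_bot hφ hext hM hF hrel ih') ih'

end Components

/-! ### Polynomial conditions -/

section Polynomials

variable {K : Type*} [Field K] {σ τ : Type*}

/-- The dimension of the kernel of a linear map that depends linearly on parameters is upper
semicontinuous in the Zariski topology. -/
theorem exists_polynomial_finrank_ker_le [Fintype σ] {W T : Type*} [AddCommGroup W] [Module K W]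
    [FiniteDimensional K W] [AddCommGroup T] [Module K T] (A : (σ → K) →ₗ[K] W →ₗ[K] T)
    (x₀ : σ → K) :
    ∃ Q : MvPolynomial σ K, MvPolynomial.eval x₀ Q ≠ 0 ∧ ∀ x, MvPolynomial.eval x Q ≠ 0 →
      Module.finrank K (LinearMap.ker (A x)) ≤ Module.finrank K (LinearMap.ker (A x₀)) := by
  classical
  -- With `B` a left inverse of `A x₀` on a complement of its kernel, `p` is the projection onto
  -- that kernel and `B ∘ₗ A x + p` is the identity at `x₀`. Where its determinant is nonzero, `p`
  -- embeds `ker (A x)` into `ker (A x₀)`.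
  obtain ⟨q, hq⟩ := Submodule.exists_isCompl (LinearMap.ker (A x₀))
  obtain ⟨g, hg⟩ := LinearMap.exists_leftInverse_of_injective ((A x₀).domRestrict q) (by
    rw [LinearMap.ker_eq_bot']
    intro m hm
    have h : (m : W) ∈ LinearMap.ker (A x₀) ⊓ q := ⟨hm, m.2⟩
    rw [hq.inf_eq_bot, Submodule.mem_bot] at h
    exact Subtype.ext h)
  let B : T →ₗ[K] W := q.subtype ∘ₗ g
  let p : W →ₗ[K] W := LinearMap.id - B ∘ₗ A x₀
  have hp : ∀ w, p w ∈ LinearMap.ker (A x₀) := by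
    intro w
    obtain ⟨a, ha, b, hb, rfl⟩ := Submodule.mem_sup.1
      (show w ∈ LinearMap.ker (A x₀) ⊔ q by rw [hq.sup_eq_top]; trivial)
    have h1 : g (A x₀ b) = ⟨b, hb⟩ := LinearMap.congr_fun hg ⟨b, hb⟩
    have h2 : p (a + b) = a := by
      simp [p, B, LinearMap.mem_ker.1 ha, h1]
    rwa [h2]
  let b := Module.finBasis K W
  let m : (W →ₗ[K] W) →ₗ[K] Matrix _ _ K := (LinearMap.toMatrix b b).toLinearMap
  let Q : MvPolynomial σ K := Matrix.det (Matrix.of fun r s =>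
    ∑ i, MvPolynomial.X i * MvPolynomial.C (m (B ∘ₗ A (Pi.single i 1)) r s) +
      MvPolynomial.C (m p r s))
  have hQ : ∀ x, MvPolynomial.eval x Q = LinearMap.det (B ∘ₗ A x + p) := by
    intro x
    rw [← LinearMap.det_toMatrix b, RingHom.map_det]
    congr 1
    ext r s
    have hx : x = ∑ i, x i • Pi.single i (1 : K) := by
      ext i; simp [Finset.sum_apply, Pi.single_apply]
    have h1 : m (B ∘ₗ A x + p) = ∑ i, x i • m (B ∘ₗ A (Pi.single i 1)) + m p := by
      have h2 : B ∘ₗ A x = ∑ i, x i • (B ∘ₗ A (Pi.single i 1)) := by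
        conv_lhs => rw [hx]
        ext w
        simp
      rw [h2]
      simp only [map_sum, map_smul, map_add]
    change _ = m (B ∘ₗ A x + p) r s
    rw [h1]
    simp [Matrix.sum_apply]
  refine ⟨Q, ?_, fun x hx => ?_⟩
  · rw [hQ, show B ∘ₗ A x₀ + p = LinearMap.id by simp [p], LinearMap.det_id]
    exact one_ne_zero
  · rw [hQ] at hx
    refine finrank_le_of_injOn p (fun w _ => hp w) fun w hw w' hw' h => ?_
    have hinj : Function.Injective (B ∘ₗ A x + p) :=
      (LinearMap.equivOfDetNeZero _ hx).injective
    apply hinj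
    simp [LinearMap.mem_ker.1 hw, LinearMap.mem_ker.1 hw', h]

/-- On a set parametrized by polynomials over an infinite field, a finite product of polynomials
each of which does not vanish identically does not vanish identically. -/
theorem exists_eval_prod_ne_zero [Infinite K] (g : σ → MvPolynomial τ K) {κ : Type*}
    (s : Finset κ) (Q : κ → MvPolynomial σ K)
    (h : ∀ k ∈ s, ∃ p : τ → K, MvPolynomial.eval (fun i => MvPolynomial.eval p (g i)) (Q k) ≠ 0) :
    ∃ p : τ → K, MvPolynomial.eval (fun i => MvPolynomial.eval p (g i)) (∏ k ∈ s, Q k) ≠ 0 := by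
  have heval : ∀ (p : τ → K) (P : MvPolynomial σ K),
      MvPolynomial.eval (fun i => MvPolynomial.eval p (g i)) P =
        MvPolynomial.eval p (MvPolynomial.bind₁ g P) :=
    fun p P => (MvPolynomial.eval₂Hom_bind₁ (RingHom.id K) p g P).symm
  have h0 : MvPolynomial.bind₁ g (∏ k ∈ s, Q k) ≠ 0 := by
    rw [map_prod, Finset.prod_ne_zero_iff]
    intro k hk h0
    obtain ⟨p, hp⟩ := h k hk
    rw [heval, h0, map_zero] at hp
    exact hp rfl
  by_contra! hcon
  refine h0 (MvPolynomial.funext fun p => ?_)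
  rw [← heval, hcon, map_zero]

variable [Fintype σ] {V ι M : Type*} [Fintype V] [DecidableEq V] [Fintype ι]
  [AddCommGroup M] [Module K M] [FiniteDimensional K M]

/-- The dimension of the space of relations is upper semicontinuous. -/
theorem exists_polynomial_finrank_relations_le (φ : (σ → K) →ₗ[K] V → Module.Dual K M)
    (F : ι → Finset V) (x₀ : σ → K) :
    ∃ Q : MvPolynomial σ K, MvPolynomial.eval x₀ Q ≠ 0 ∧ ∀ x, MvPolynomial.eval x Q ≠ 0 →
      Module.finrank K (relations (φ x) F) ≤ Module.finrank K (relations (φ x₀) F) := by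
  -- Relations without hyperplane conditions form a space independent of `x`; the hyperplane
  -- conditions then cut out the kernel of a map linear in `x`.
  let W := relations (0 : V → Module.Dual K M) F
  let A : (σ → K) →ₗ[K] W →ₗ[K] (ι → V → K) := LinearMap.mk₂ K
    (fun x y i v => φ x v (y.1 i v)) (fun _ _ _ => by ext; simp) (fun _ _ _ => by ext; simp)
    (fun _ _ _ => by ext; simp) (fun _ _ _ => by ext; simp)
  have hA : ∀ x, relations (φ x) F = (LinearMap.ker (A x)).map W.subtype := by
    intro x
    ext y
    rw [Submodule.mem_map]
    constructor
    · intro hy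
      have hy' := mem_relations.1 hy
      refine ⟨⟨y, mem_relations.2 ⟨fun i => ?_, hy'.2⟩⟩, ?_, rfl⟩
      · have := mem_blockSpace.1 (hy'.1 i)
        exact mem_blockSpace.2 ⟨this.1, fun _ => rfl, this.2.2⟩
      · rw [LinearMap.mem_ker]
        funext i v
        exact (mem_blockSpace.1 (hy'.1 i)).2.1 v
    · rintro ⟨⟨y, hyW⟩, hy, rfl⟩
      have hyW' := mem_relations.1 hyW
      refine mem_relations.2 ⟨fun i => ?_, hyW'.2⟩
      have := mem_blockSpace.1 (hyW'.1 i)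
      exact mem_blockSpace.2 ⟨this.1, fun v => congrFun (congrFun (LinearMap.mem_ker.1 hy) i) v,
        this.2.2⟩
  obtain ⟨Q, hQ, hQ'⟩ := exists_polynomial_finrank_ker_le A x₀
  refine ⟨Q, hQ, fun x hx => ?_⟩
  rw [hA, hA, Submodule.finrank_map_subtype_eq, Submodule.finrank_map_subtype_eq]
  exact hQ' x hx

/-- The points at which the dimensions of all spaces of relations are minimal, among the points of
a nonempty set `C`, contain the complement of the zero set of a polynomial. -/
theorem exists_polynomial_forall_finrank_relations_le (φ : (σ → K) →ₗ[K] V → Module.Dual K M)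
    {C : Set (σ → K)} (hC : C.Nonempty) (F : ι → Finset V) :
    ∃ Q : MvPolynomial σ K, (∃ x ∈ C, MvPolynomial.eval x Q ≠ 0) ∧
      ∀ x, MvPolynomial.eval x Q ≠ 0 → ∀ x' ∈ C,
        Module.finrank K (relations (φ x) F) ≤ Module.finrank K (relations (φ x') F) := by
  obtain ⟨x₀, hx₀, hmin⟩ : ∃ x₀ ∈ C, ∀ x ∈ C, Module.finrank K (relations (φ x₀) F) ≤
      Module.finrank K (relations (φ x) F) := by
    let f : (σ → K) → ℕ := fun x => Module.finrank K (relations (φ x) F)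
    exact ⟨_, Function.argminOn_mem f C hC, fun x hx => Function.argminOn_le f C hx⟩
  obtain ⟨Q, hQ, hQ'⟩ := exists_polynomial_finrank_relations_le φ F x₀
  exact ⟨Q, ⟨x₀, hx₀, hQ⟩, fun x hx x' hx' => (hQ' x hx).trans (hmin x' hx')⟩

end Polynomials

/-! ### Decomposable vectors and the pairing -/

section Plucker

/-- The standard basis vectors are decomposable. -/
theorem exists_pluckerVector_eq_single {n k : ℕ} (J : PluckerIndex n k) :
    ∃ P : Matrix (Fin k) (Fin n) ℝ, pluckerVector P = Pi.single J 1 := by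
  classical
  refine ⟨Matrix.of fun i j => if j = Finset.orderEmbOfFin J.1 J.2 i then 1 else 0, ?_⟩
  funext I
  rw [pluckerVector]
  by_cases h : I = J
  · subst h
    rw [Pi.single_eq_same, ← Matrix.det_one (n := Fin k)]
    congr 1
    ext i j
    simp [Matrix.one_apply, eq_comm]
  · rw [Pi.single_eq_of_ne h]
    obtain ⟨x, hxJ, hxI⟩ : ∃ x ∈ J.1, x ∉ I.1 := by
      by_contra! hcon
      exact h (Subtype.ext (Finset.eq_of_subset_of_card_le hcon (I.2.trans J.2.symm).le).symm)
    obtain ⟨i, rfl⟩ : x ∈ Set.range (Finset.orderEmbOfFin J.1 J.2) :=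
      (Finset.range_orderEmbOfFin J.1 J.2).ge hxJ
    refine Matrix.det_eq_zero_of_row_eq_zero i fun j => ?_
    have : Finset.orderEmbOfFin I.1 I.2 j ≠ Finset.orderEmbOfFin J.1 J.2 i := fun h' =>
      hxI (h' ▸ Finset.orderEmbOfFin_mem I.1 I.2 j)
    simp [this]

theorem exists_pluckerVector_eq_smul {n k : ℕ} (hk : 0 < k) (a : ℝ)
    (P : Matrix (Fin k) (Fin n) ℝ) :
    ∃ P' : Matrix (Fin k) (Fin n) ℝ, pluckerVector P' = a • pluckerVector P := by
  refine ⟨P.updateRow ⟨0, hk⟩ (a • P ⟨0, hk⟩), funext fun I => ?_⟩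
  let N := P.submatrix id (Finset.orderEmbOfFin I.1 I.2)
  have h : (P.updateRow ⟨0, hk⟩ (a • P ⟨0, hk⟩)).submatrix id (Finset.orderEmbOfFin I.1 I.2) =
      N.updateRow ⟨0, hk⟩ (a • N ⟨0, hk⟩) := by
    ext i j
    by_cases hi : i = ⟨0, hk⟩ <;> simp [N, Matrix.updateRow_apply, hi]
  change Matrix.det _ = a * Matrix.det N
  rw [h, Matrix.det_updateRow_smul, Matrix.updateRow_eq_self]

variable {d : ℕ}

/-- The functional on `⋀² ℝ^{d+1}` given by an element of `⋀^{d-1} ℝ^{d+1}`. -/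
def pairing (d : ℕ) :
    PluckerSpace (d + 1) (d - 1) →ₗ[ℝ] Module.Dual ℝ (PluckerSpace (d + 1) 2) :=
  LinearMap.mk₂ ℝ (fun q p => pluckerProduct p q)
    (fun _ _ _ => by
      simp only [pluckerProduct, ← Finset.sum_add_distrib, Pi.add_apply, mul_add])
    (fun a q p => by
      simp only [pluckerProduct, Pi.smul_apply, smul_eq_mul, Finset.mul_sum]
      exact Finset.sum_congr rfl fun _ _ => by ring)
    (fun _ _ _ => by
      simp only [pluckerProduct, ← Finset.sum_add_distrib, Pi.add_apply, mul_add, add_mul])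
    (fun a q p => by
      simp only [pluckerProduct, Pi.smul_apply, smul_eq_mul, Finset.mul_sum]
      exact Finset.sum_congr rfl fun _ _ => by ring)

theorem pairing_apply (q : PluckerSpace (d + 1) (d - 1)) (p : PluckerSpace (d + 1) 2) :
    pairing d q p = pluckerProduct p q := rfl

theorem complIndex_injective : Function.Injective (complIndex (d := d)) := fun _ _ h =>
  Subtype.ext (compl_injective (congrArg Subtype.val h))

/-- The basis vector complementary to a nonzero coordinate of `β` suffices, and it is decomposable.
So a rod can be moved until its hyperplane misses `β`. -/
theorem exists_pairing_pluckerVector_ne_zero {β : PluckerSpace (d + 1) 2} (hβ : β ≠ 0) :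
    ∃ P : Matrix (Fin (d - 1)) (Fin (d + 1)) ℝ, pairing d (pluckerVector P) β ≠ 0 := by
  obtain ⟨I, hI⟩ := Function.ne_iff.1 hβ
  obtain ⟨P, hP⟩ := exists_pluckerVector_eq_single (complIndex I)
  refine ⟨P, ?_⟩
  rw [hP, pairing_apply, pluckerProduct, Finset.sum_eq_single I]
  · simpa using hI
  · intro J _ hJ
    rw [Pi.single_eq_of_ne (complIndex_injective.ne hJ), mul_zero]
  · simp

theorem pairing_injective (hd : 1 ≤ d) : Function.Injective (pairing d) := by
  rw [injective_iff_map_eq_zero]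
  intro q hq
  funext J
  have hJ : (J.1ᶜ).card = 2 := by
    have h : J.1.card = d - 1 := J.2
    rw [Finset.card_compl, h, Fintype.card_fin]
    omega
  let I : PluckerIndex (d + 1) 2 := ⟨J.1ᶜ, hJ⟩
  have hI : complIndex I = J := Subtype.ext (compl_compl J.1)
  have h := LinearMap.congr_fun hq (Pi.single I 1)
  rw [pairing_apply, pluckerProduct, Finset.sum_eq_single I] at h
  · simpa [hI] using h
  · intro I' _ hI'
    rw [Pi.single_eq_of_ne hI', mul_zero, zero_mul]
  · simp

theorem card_pluckerIndex (n k : ℕ) : Fintype.card (PluckerIndex n k) = n.choose k := by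
  rw [← Nat.card_eq_fintype_card, Set.powersetCard.card, Nat.card_fin]

theorem finrank_pluckerSpace (n k : ℕ) :
    Module.finrank ℝ (PluckerSpace n k) = n.choose k := by
  rw [Module.finrank_fintype_fun_eq_card, card_pluckerIndex]

theorem six_le_choose_two (hd : 3 ≤ d) : 6 ≤ (d + 1).choose 2 :=
  (Nat.choose_le_choose 2 (show 4 ≤ d + 1 by omega)).trans' (by decide)

end Plucker

/-! ### The functionals of a system of coordinates -/

section Coordinates

open Classical in
/-- The functionals defining the hyperplanes of the vertices, where `x` lists the coordinates of
the rods. -/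
def rodFunctional (V : Type*) (d : ℕ) (R : Set V) :
    (R × PluckerIndex (d + 1) (d - 1) → ℝ) →ₗ[ℝ] V → Module.Dual ℝ (PluckerSpace (d + 1) 2) :=
  LinearMap.pi fun v => if h : v ∈ R then
    pairing d ∘ₗ LinearMap.pi fun I => LinearMap.proj (⟨v, h⟩, I) else 0

variable {V ι : Type*} {d : ℕ} {R : Set V}

theorem rodFunctional_of_mem (x : R × PluckerIndex (d + 1) (d - 1) → ℝ) {v : V} (h : v ∈ R) :
    rodFunctional V d R x v = pairing d fun I => x (⟨v, h⟩, I) := by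
  simp [rodFunctional, h]
  rfl

theorem rodFunctional_of_notMem (x : R × PluckerIndex (d + 1) (d - 1) → ℝ) {v : V} (h : v ∉ R) :
    rodFunctional V d R x v = 0 := by
  simp [rodFunctional, h]

/-- The coordinates all of whose rods are decomposable. -/
def decomposableCoordinates (d : ℕ) (R : Set V) : Set (R × PluckerIndex (d + 1) (d - 1) → ℝ) :=
  {x | ∀ v, ∃ P, pluckerVector P = fun I => x (v, I)}

/-- The polynomials parametrizing the decomposable coordinates. -/
def minorPolynomial (d : ℕ) (R : Set V) (i : R × PluckerIndex (d + 1) (d - 1)) :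
    MvPolynomial (R × Fin (d - 1) × Fin (d + 1)) ℝ :=
  Matrix.det (Matrix.of fun a b =>
    MvPolynomial.X (i.1, a, Finset.orderEmbOfFin i.2.1 i.2.2 b))

theorem eval_minorPolynomial (p : R × Fin (d - 1) × Fin (d + 1) → ℝ)
    (i : R × PluckerIndex (d + 1) (d - 1)) :
    MvPolynomial.eval p (minorPolynomial d R i) =
      pluckerVector (Matrix.of fun a b => p (i.1, a, b)) i.2 := by
  rw [minorPolynomial, RingHom.map_det, pluckerVector]
  congr 1
  ext a b
  simp

theorem mem_decomposableCoordinates_iff {x : R × PluckerIndex (d + 1) (d - 1) → ℝ} :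
    x ∈ decomposableCoordinates d R ↔
      ∃ p, x = fun i => MvPolynomial.eval p (minorPolynomial d R i) := by
  constructor
  · intro h
    choose P hP using h
    refine ⟨fun i => P i.1 i.2.1 i.2.2, funext fun i => ?_⟩
    rw [eval_minorPolynomial]
    exact (congrFun (hP i.1) i.2).symm
  · rintro ⟨p, rfl⟩ v
    exact ⟨Matrix.of fun a b => p (v, a, b),
      funext fun I => (eval_minorPolynomial p (v, I)).symm⟩

theorem RodConfiguration.IsCoordinates.mem_decomposableCoordinates (hd : 3 ≤ d)
    {r : RodConfiguration d R} {c : R → PluckerSpace (d + 1) (d - 1)} (hc : r.IsCoordinates c) :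
    (fun i => c i.1 i.2) ∈ decomposableCoordinates d R := by
  intro v
  obtain ⟨h0, hv⟩ := hc v
  obtain ⟨P, hP, hr⟩ := r.mem_grassmannian v
  obtain ⟨a, ha⟩ := (Projectivization.mk_eq_mk_iff' ℝ _ _ h0 hP).1 (hv.trans hr)
  obtain ⟨P', hP'⟩ := exists_pluckerVector_eq_smul (show 0 < d - 1 by omega) a P
  exact ⟨P', hP'.trans ha⟩

/-- Two hyperplanes that do not span coincide, so their functionals are proportional; injectivity of
`pairing` then makes the rods equal as projective points. -/
theorem RodConfiguration.IsCoordinates.isSpread (hd : 3 ≤ d) {r : RodConfiguration d R}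
    {c : R → PluckerSpace (d + 1) (d - 1)} (hc : r.IsCoordinates c) :
    IsSpread (rodFunctional V d R fun i => c i.1 i.2) := by
  intro u w huw
  by_cases hu : u ∈ R
  swap
  · rw [rodFunctional_of_notMem _ hu, LinearMap.ker_zero, top_sup_eq]
  by_cases hw : w ∈ R
  swap
  · rw [rodFunctional_of_notMem _ hw, LinearMap.ker_zero, sup_top_eq]
  rw [rodFunctional_of_mem _ hu, rodFunctional_of_mem _ hw]
  change LinearMap.ker (pairing d (c ⟨u, hu⟩)) ⊔ LinearMap.ker (pairing d (c ⟨w, hw⟩)) = ⊤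
  obtain ⟨hu0, hur⟩ := hc ⟨u, hu⟩
  obtain ⟨hw0, hwr⟩ := hc ⟨w, hw⟩
  generalize c ⟨u, hu⟩ = a at *
  generalize c ⟨w, hw⟩ = b at *
  by_contra hcon
  have hle : LinearMap.ker (pairing d b) ≤ LinearMap.ker (pairing d a) := by
    intro y hy
    by_contra hya
    refine hcon (top_le_iff.1 ?_)
    rw [← LinearMap.span_singleton_sup_ker_eq_top (pairing d a) hya, sup_comm]
    exact sup_le_sup_left ((Submodule.span_singleton_le_iff_mem _ _).2 hy) _
  obtain ⟨x, hx⟩ : ∃ x, pairing d b x ≠ 0 := by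
    by_contra! h
    exact hw0 (pairing_injective (by omega) ((LinearMap.ext h).trans (map_zero _).symm))
  have hab : a = (pairing d a x / pairing d b x) • b := by
    refine pairing_injective (by omega) (LinearMap.ext fun m => ?_)
    have h1 : m - (pairing d b m / pairing d b x) • x ∈ LinearMap.ker (pairing d b) := by
      rw [LinearMap.mem_ker, map_sub, map_smul, smul_eq_mul, div_mul_cancel₀ _ hx, sub_self]
    have h2 := LinearMap.mem_ker.1 (hle h1)
    rw [map_sub, map_smul, smul_eq_mul, sub_eq_zero] at h2
    rw [h2, map_smul, LinearMap.smul_apply, smul_eq_mul]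
    ring
  have hrod := (Projectivization.mk_eq_mk_iff' ℝ a b hu0 hw0).2 ⟨_, hab.symm⟩
  rw [hur, hwr] at hrod
  exact huw (congrArg Subtype.val (r.injective hrod))

variable [Fintype V] [DecidableEq V] [Fintype ι]

/-- Coordinates minimizing the dimensions of the spaces of relations among the decomposable
coordinates are extremal. -/
theorem isExtremal_rodFunctional {x : R × PluckerIndex (d + 1) (d - 1) → ℝ}
    (hx : x ∈ decomposableCoordinates d R)
    (h : ∀ F : ι → Finset V, ∀ x' ∈ decomposableCoordinates d R,
      Module.finrank ℝ (relations (rodFunctional V d R x) F) ≤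
        Module.finrank ℝ (relations (rodFunctional V d R x') F)) :
    IsExtremal ι (rodFunctional V d R x) := by
  classical
  intro v hv β hβ
  have hvR : v ∈ R := by
    by_contra hvR
    exact hv (rodFunctional_of_notMem x hvR)
  obtain ⟨P, hP⟩ := exists_pairing_pluckerVector_ne_zero hβ
  refine ⟨_, hP, fun F => ?_⟩
  -- Only the rod of `v` is replaced. The new rods may coincide, which is why minimality is taken
  -- over all decomposable coordinates rather than over rod-configurations.
  let x' : R × PluckerIndex (d + 1) (d - 1) → ℝ :=
    fun i => if (i.1 : V) = v then pluckerVector P i.2 else x i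
  have hx' : x' ∈ decomposableCoordinates d R := by
    intro w
    by_cases hw : (w : V) = v
    · exact ⟨P, by simp [x', hw]⟩
    · simpa [x', hw] using hx w
  have hupd : Function.update (rodFunctional V d R x) v (pairing d (pluckerVector P)) =
      rodFunctional V d R x' := by
    funext w
    by_cases hw : w = v
    · subst hw
      rw [Function.update_self, rodFunctional_of_mem _ hvR]
      simp [x']
    · rw [Function.update_of_ne hw]
      by_cases hwR : w ∈ R
      · rw [rodFunctional_of_mem _ hwR, rodFunctional_of_mem _ hwR]
        simp [x', hw]
      · rw [rodFunctional_of_notMem _ hwR, rodFunctional_of_notMem _ hwR]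
  rw [hupd]
  exact h F x' hx'

open Classical in
/-- Almost all rod-configurations are extremal. -/
theorem exists_polynomial_isExtremal (ι : Type*) [Fintype ι] (hd : 3 ≤ d) (R : Set V) :
    ∃ Q : MvPolynomial (R × PluckerIndex (d + 1) (d - 1)) ℝ,
      (∃ (r : RodConfiguration d R) (c : R → PluckerSpace (d + 1) (d - 1)),
        r.IsCoordinates c ∧ MvPolynomial.eval (fun i => c i.1 i.2) Q ≠ 0) ∧
      ∀ (r : RodConfiguration d R) (c : R → PluckerSpace (d + 1) (d - 1)),
        r.IsCoordinates c → MvPolynomial.eval (fun i => c i.1 i.2) Q ≠ 0 →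
          IsExtremal ι (rodFunctional V d R fun i => c i.1 i.2) := by
  obtain ⟨I₀, I₁, hI⟩ : ∃ I₀ I₁ : PluckerIndex (d + 1) (d - 1), I₀ ≠ I₁ := by
    refine Fintype.exists_pair_of_one_lt_card ?_
    rw [card_pluckerIndex, show d - 1 = d + 1 - 2 by omega, Nat.choose_symm (by omega)]
    exact (six_le_choose_two hd).trans_lt' (by norm_num)
  have hbasis : ∀ J : R → PluckerIndex (d + 1) (d - 1),
      (fun i => Pi.single (M := fun _ => ℝ) (J i.1) 1 i.2) ∈ decomposableCoordinates d R :=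
    fun J v => exists_pluckerVector_eq_single (J v)
  choose Q hQ hQ' using fun F : ι → Finset V =>
    exists_polynomial_forall_finrank_relations_le (rodFunctional V d R)
      ⟨_, hbasis fun _ => I₀⟩ F
  -- These factors ensure that a parameter point where the product is nonzero yields a genuine
  -- rod-configuration: the diagonal ones make the coordinates nonzero, the `2 × 2` minors make the
  -- points distinct.
  let Q₂ : R × R → MvPolynomial (R × PluckerIndex (d + 1) (d - 1)) ℝ := fun e =>
    if e.1 = e.2 then MvPolynomial.X (e.1, I₀) else
      MvPolynomial.X (e.1, I₀) * MvPolynomial.X (e.2, I₁) -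
        MvPolynomial.X (e.1, I₁) * MvPolynomial.X (e.2, I₀)
  have hQ₂ : ∀ e, ∃ x ∈ decomposableCoordinates d R, MvPolynomial.eval x (Q₂ e) ≠ 0 := by
    intro e
    refine ⟨_, hbasis fun v => if v = e.1 then I₀ else I₁, ?_⟩
    by_cases h : e.1 = e.2
    · simp [Q₂, ← h]
    · simp [Q₂, h, Ne.symm h, Pi.single_eq_of_ne hI.symm]
  obtain ⟨p, hp⟩ := exists_eval_prod_ne_zero (minorPolynomial d R)
    (Finset.univ : Finset ((ι → Finset V) ⊕ (R × R))) (Sum.elim Q Q₂) (by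
      rintro (F | e) -
      · obtain ⟨x, hx, hx'⟩ := hQ F
        obtain ⟨p, rfl⟩ := mem_decomposableCoordinates_iff.1 hx
        exact ⟨p, hx'⟩
      · obtain ⟨x, hx, hx'⟩ := hQ₂ e
        obtain ⟨p, rfl⟩ := mem_decomposableCoordinates_iff.1 hx
        exact ⟨p, hx'⟩)
  refine ⟨∏ k, Sum.elim Q Q₂ k, ?_, fun r c hc hne => ?_⟩
  · set x : R × PluckerIndex (d + 1) (d - 1) → ℝ :=
      fun i => MvPolynomial.eval p (minorPolynomial d R i) with hx
    have hxdec : x ∈ decomposableCoordinates d R := mem_decomposableCoordinates_iff.2 ⟨p, rfl⟩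
    choose P hP using hxdec
    have hx2 : ∀ e, MvPolynomial.eval x (Q₂ e) ≠ 0 := by
      intro e
      rw [map_prod, Finset.prod_ne_zero_iff] at hp
      exact hp (Sum.inr e) (Finset.mem_univ _)
    have hP0 : ∀ v, pluckerVector (P v) ≠ 0 := by
      intro v h0
      refine hx2 (v, v) ?_
      rw [hP] at h0
      simpa [Q₂] using congrFun h0 I₀
    refine ⟨⟨fun v => Projectivization.mk ℝ (pluckerVector (P v)) (hP0 v),
      fun v => ⟨P v, hP0 v, rfl⟩, fun u w h => ?_⟩, fun v => pluckerVector (P v),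
      fun v => ⟨hP0 v, rfl⟩, ?_⟩
    · obtain ⟨a, ha⟩ := (Projectivization.mk_eq_mk_iff' ℝ _ _ (hP0 u) (hP0 w)).1 h
      by_contra huw
      refine hx2 (u, w) ?_
      have h1 : ∀ I, x (u, I) = a * x (w, I) := by
        intro I
        have := congrFun ha I
        rw [hP, hP] at this
        exact this.symm
      simp [Q₂, huw, h1]
      ring
    · have : (fun i : R × PluckerIndex (d + 1) (d - 1) => pluckerVector (P i.1) i.2) = x :=
        funext fun i => congrFun (hP i.1) i.2
      rw [this]
      exact hp
  · refine isExtremal_rodFunctional (hc.mem_decomposableCoordinates hd) fun F => hQ' F _ ?_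
    rw [map_prod, Finset.prod_ne_zero_iff] at hne
    exact hne (Sum.inl F) (Finset.mem_univ _)

end Coordinates

/-! ### The polymatroid of a graph -/

section Graphs

variable {V E : Type*} [Fintype V] [DecidableEq V] [Fintype E] [DecidableEq E] {d : ℕ}
  {G : Graph V E} {R : Set V} {r : RodConfiguration d R}
  {c : R → PluckerSpace (d + 1) (d - 1)}

open Classical in
/-- The block of an edge `e ∈ F`: its set of ends. -/
def endsIn (G : Graph V E) (F : Finset E) (e : E) : Finset V :=
  if e ∈ F then Finset.univ.filter (G.Inc e) else ∅

theorem mem_endsIn {F : Finset E} {e : E} {v : V} : v ∈ endsIn G F e ↔ e ∈ F ∧ G.Inc e v := by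
  by_cases h : e ∈ F <;> simp [endsIn, h]

theorem endsIn_eq_pair {F : Finset E} {e : E} (he : e ∈ F) {u v : V} (h : G.IsLink e u v) :
    endsIn G F e = {u, v} := by
  ext w
  rw [mem_endsIn, Finset.mem_insert, Finset.mem_singleton]
  constructor
  · exact fun hw => hw.2.eq_or_eq_of_isLink h
  · rintro (rfl | rfl)
    · exact ⟨he, h.inc_left⟩
    · exact ⟨he, h.inc_right⟩

theorem two_le_card_endsIn [G.Loopless] {F : Finset E} (hF : (F : Set E) ⊆ E(G)) {e : E}
    (he : e ∈ F) : 2 ≤ (endsIn G F e).card := by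
  obtain ⟨u, v, h⟩ := G.exists_isLink_of_mem_edgeSet (hF he)
  rw [endsIn_eq_pair he h, Finset.card_pair h.ne]

theorem coe_biUnion_endsIn {F Y : Finset E} (hY : Y ⊆ F) :
    ((Y.biUnion (endsIn G F) : Finset V) : Set V) = spanned G Y := by
  ext v
  simp only [Finset.mem_coe, Finset.mem_biUnion, mem_endsIn, spanned, Set.mem_ofPred_eq]
  exact ⟨fun ⟨e, he, _, h⟩ => ⟨e, he, h⟩, fun ⟨e, he, h⟩ => ⟨e, he, hY he, h⟩⟩

/-- The chosen representative of a rod and its coordinates `c` differ by a unit, which does not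
affect the hyperplane. -/
theorem RodConfiguration.IsCoordinates.hyperplane_eq (hc : r.IsCoordinates c) (v : V) :
    r.hyperplane v = LinearMap.ker (rodFunctional V d R (fun i => c i.1 i.2) v) := by
  ext α
  rw [RodConfiguration.hyperplane, Submodule.mem_iInf, LinearMap.mem_ker]
  by_cases hv : v ∈ R
  · rw [rodFunctional_of_mem _ hv]
    obtain ⟨h0, hr⟩ := hc ⟨v, hv⟩
    obtain ⟨a, ha⟩ := Projectivization.exists_smul_eq_mk_rep ℝ _ h0
    rw [hr] at ha
    have h1 : pluckerProduct α (r.rod ⟨v, hv⟩).rep = a * pairing d (c ⟨v, hv⟩) α := by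
      rw [← pairing_apply, ← ha, Units.smul_def, map_smul, LinearMap.smul_apply, smul_eq_mul]
    constructor
    · intro h
      have h2 : pluckerProduct α (r.rod ⟨v, hv⟩).rep = 0 := h hv
      rw [h1] at h2
      exact (mul_eq_zero.1 h2).resolve_left a.ne_zero
    · intro h _
      change pluckerProduct α (r.rod ⟨v, hv⟩).rep = 0
      rw [h1]
      exact mul_eq_zero_of_right _ h
  · rw [rodFunctional_of_notMem _ hv]
    simp [hv]

theorem RodConfiguration.IsCoordinates.edgeFlat_eq [G.Loopless] (hc : r.IsCoordinates c)
    {F : Finset E} (hF : (F : Set E) ⊆ E(G)) {e : E} (he : e ∈ F) :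
    r.edgeFlat G e = blockSpace (rodFunctional V d R fun i => c i.1 i.2) (endsIn G F e) := by
  classical
  set φ := rodFunctional V d R fun i => c i.1 i.2
  apply le_antisymm
  · refine iSup_le fun u => iSup_le fun v => iSup_le fun h => ?_
    rintro _ ⟨α, ⟨hu, hv⟩, rfl⟩
    rw [hc.hyperplane_eq] at hu hv
    rw [endsIn_eq_pair he h]
    refine ⟨?_, by simp⟩
    have h1 : Pi.single u α ∈ sectionSpace φ {u, v} :=
      single_mem_sectionSpace (by simp) (LinearMap.mem_ker.1 hu)
    have h2 : Pi.single v α ∈ sectionSpace φ {u, v} :=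
      single_mem_sectionSpace (by simp) (LinearMap.mem_ker.1 hv)
    convert Submodule.sub_mem _ h1 h2 using 1
    rw [LinearMap.sub_apply, LinearMap.coe_single, LinearMap.coe_single]
    congr!
  · obtain ⟨u, v, h⟩ := G.exists_isLink_of_mem_edgeSet (hF he)
    intro x hx
    rw [endsIn_eq_pair he h, mem_blockSpace] at hx
    obtain ⟨hx1, hx2, hx3⟩ := hx
    have hx4 : x u + x v = 0 := by
      rw [← hx3, ← Finset.sum_pair h.ne]
      exact Finset.sum_subset (Finset.subset_univ _) fun w _ hw => hx1 w hw
    have hv : x v = -x u := eq_neg_of_add_eq_zero_right hx4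
    refine Submodule.mem_iSup_of_mem u (Submodule.mem_iSup_of_mem v
      (Submodule.mem_iSup_of_mem h ⟨x u, ⟨?_, ?_⟩, ?_⟩))
    · rw [hc.hyperplane_eq]; exact hx2 u
    · rw [hc.hyperplane_eq]
      have := hx2 v
      rw [hv, map_neg, neg_eq_zero] at this
      exact this
    · funext w
      rw [LinearMap.sub_apply, LinearMap.coe_single, LinearMap.coe_single, Pi.sub_apply]
      by_cases hwu : w = u
      · subst hwu
        simp [h.ne]
      by_cases hwv : w = v
      · subst hwv
        simp [hwu, hv]
      · simp [hwu, hwv, hx1 w (by simp [hwu, hwv])]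

theorem RodConfiguration.IsCoordinates.rank_eq [G.Loopless] (hc : r.IsCoordinates c)
    {F : Finset E} (hF : (F : Set E) ⊆ E(G)) :
    r.rank G F = Module.finrank ℝ (⨆ e, blockSpace (rodFunctional V d R fun i => c i.1 i.2)
      (endsIn G F e) : Submodule ℝ (V → PluckerSpace (d + 1) 2)) := by
  refine congrArg (fun S : Submodule ℝ (V → PluckerSpace (d + 1) 2) => Module.finrank ℝ S) ?_
  refine le_antisymm (iSup₂_le fun e he => ?_) (iSup_le fun e => ?_)
  · rw [hc.edgeFlat_eq hF he]
    exact le_iSup (fun e => blockSpace _ (endsIn G F e)) e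
  · by_cases he : e ∈ F
    · rw [← hc.edgeFlat_eq hF he]
      exact le_iSup₂_of_le e he le_rfl
    · rw [endsIn, if_neg he, blockSpace_eq_bot (by simp)]
      exact bot_le

theorem RodConfiguration.IsCoordinates.finrank_blockSpace (hd : 3 ≤ d) (hc : r.IsCoordinates c)
    {X : Finset V} (hX : 2 ≤ X.card) :
    (Module.finrank ℝ (blockSpace (rodFunctional V d R fun i => c i.1 i.2) X) : ℤ) =
      ((d + 1).choose 2 : ℤ) * (X : Set V).ncard - ((d + 1).choose 2 : ℤ) -
        ((X : Set V) ∩ R).ncard := by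
  classical
  have h := BodyRodBar.finrank_blockSpace ((hc.isSpread hd).sumSpace_eq_top hX)
  rw [finrank_pluckerSpace] at h
  have hker : ∀ v, Module.finrank ℝ
      (LinearMap.ker (rodFunctional V d R (fun i => c i.1 i.2) v)) + (if v ∈ R then 1 else 0) =
        (d + 1).choose 2 := by
    intro v
    by_cases hv : v ∈ R
    · rw [if_pos hv, rodFunctional_of_mem _ hv, ← finrank_pluckerSpace]
      refine Module.Dual.finrank_ker_add_one_of_ne_zero fun h0 => ?_
      obtain ⟨hv0, -⟩ := hc ⟨v, hv⟩
      exact hv0 (pairing_injective (by omega) (h0.trans (map_zero _).symm))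
    · rw [if_neg hv, rodFunctional_of_notMem _ hv, LinearMap.ker_zero, finrank_top,
        finrank_pluckerSpace, add_zero]
  have hsum := Finset.sum_congr (rfl : X = X) fun v _ => hker v
  rw [Finset.sum_add_distrib, Finset.sum_boole, Finset.sum_const, smul_eq_mul] at hsum
  have hcard : ((X : Set V) ∩ R).ncard = (X.filter (· ∈ R)).card := by
    rw [← Set.ncard_coe_finset, Finset.coe_filter]
    rfl
  rw [hcard, Set.ncard_coe_finset]
  push_cast at hsum
  zify at h hsum
  linarith

theorem RodConfiguration.IsCoordinates.finrank_blockSpace_eq_count [G.Loopless] (hd : 3 ≤ d)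
    (hc : r.IsCoordinates c) {F Y : Finset E} (hF : (F : Set E) ⊆ E(G)) (hY : Y ⊆ F)
    (hne : Y.Nonempty) :
    (Module.finrank ℝ (blockSpace (rodFunctional V d R fun i => c i.1 i.2)
      (Y.biUnion (endsIn G F))) : ℤ) = count d G R Y := by
  obtain ⟨e, he⟩ := hne
  rw [hc.finrank_blockSpace hd ((two_le_card_endsIn hF (hY he)).trans
    (Finset.card_le_card (Finset.subset_biUnion_of_mem _ he))), coe_biUnion_endsIn hY, count]

/-- The rank is at most the sum of the counts over any partition. -/
theorem RodConfiguration.IsCoordinates.rank_le_countHat [G.Loopless] (hd : 3 ≤ d)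
    (hc : r.IsCoordinates c) {F : Finset E} (hF : (F : Set E) ⊆ E(G)) :
    (r.rank G F : ℤ) ≤ countHat d G R F := by
  refine Finset.le_inf' _ _ fun P _ => ?_
  set φ := rodFunctional V d R fun i => c i.1 i.2
  -- Each part is replaced by its vertex set; enlarging the spaces can only raise the rank, and the
  -- dimension of a sum is at most the sum of the dimensions.
  let X : P.parts → Finset V := fun Y => Y.1.biUnion (endsIn G F)
  have h1 : r.rank G F ≤ Module.finrank ℝ
      (⨆ Y, blockSpace φ (X Y) : Submodule ℝ (V → PluckerSpace (d + 1) 2)) := by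
    rw [hc.rank_eq hF]
    refine Submodule.finrank_mono (iSup_le fun e => ?_)
    by_cases he : e ∈ F
    · obtain ⟨Y, hY, heY⟩ := P.exists_mem he
      exact le_iSup_of_le (⟨Y, hY⟩ : P.parts)
        (blockSpace_mono (Finset.subset_biUnion_of_mem _ heY))
    · rw [endsIn, if_neg he, blockSpace_eq_bot (by simp)]
      exact bot_le
  have h2 := finrank_relations_add φ X
  have h3 : (∑ Y, (Module.finrank ℝ (blockSpace φ (X Y)) : ℤ)) = ∑ Y ∈ P.parts, count d G R Y := by
    rw [← Finset.sum_coe_sort P.parts]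
    exact Finset.sum_congr rfl fun Y _ => hc.finrank_blockSpace_eq_count hd hF (P.subset Y.2)
      (P.nonempty_of_mem_parts Y.2)
  rw [← h3, ← Nat.cast_sum]
  exact_mod_cast (by omega : r.rank G F ≤ ∑ Y, Module.finrank ℝ (blockSpace φ (X Y)))

/-- The fibres of a function form a partition. -/
theorem countHat_le_sum_fiber (k : E → E) (F : Finset E) :
    countHat d G R F ≤ ∑ q ∈ F.image k, count d G R (F.filter (k · = q)) := by
  classical
  let P : Finpartition F := Finpartition.ofSetSetoid (Setoid.ker k) F
  have hP : P.parts = (F.image k).image fun q => F.filter (k · = q) := by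
    rw [Finset.image_image]
    refine Finset.image_congr fun a _ => Finset.filter_congr fun b _ => ?_
    exact Setoid.ker_def.trans eq_comm
  have hinj : Set.InjOn (fun q => F.filter (k · = q)) (F.image k : Finset E) := by
    intro q hq q' _ h
    obtain ⟨e, he, rfl⟩ := Finset.mem_image.1 hq
    have : e ∈ F.filter (k · = q') := by
      exact h.subset (Finset.mem_filter.2 ⟨he, rfl⟩)
    exact (Finset.mem_filter.1 this).2
  refine (Finset.inf'_le _ (Finset.mem_univ P)).trans_eq ?_
  rw [hP, Finset.sum_image hinj]

/-- For an extremal rod-configuration, the rank is the sum of the counts over some partition. -/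
theorem RodConfiguration.IsCoordinates.countHat_le_rank [G.Loopless] (hd : 3 ≤ d)
    (hc : r.IsCoordinates c) (hext : IsExtremal E (rodFunctional V d R fun i => c i.1 i.2))
    {F : Finset E} (hF : (F : Set E) ⊆ E(G)) :
    countHat d G R F ≤ r.rank G F := by
  set φ := rodFunctional V d R fun i => c i.1 i.2
  obtain ⟨k, hk⟩ := (hasComponents (hc.isSpread hd) hext
    (by have := six_le_choose_two hd; rw [finrank_pluckerSpace]; omega)
    (endsIn G F) (fun e => by
      by_cases he : e ∈ F
      · exact Or.inr (two_le_card_endsIn hF he)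
      · exact Or.inl (if_neg he))).exists_finrank_iSup_eq
  have hfib : ∀ q, fiberUnion k (endsIn G F) q = (F.filter (k · = q)).biUnion (endsIn G F) := by
    intro q
    ext v
    simp only [mem_fiberUnion, Finset.mem_biUnion, Finset.mem_filter, mem_endsIn]
    exact ⟨fun ⟨e, h1, h2, h3⟩ => ⟨e, ⟨h2, h1⟩, h2, h3⟩, fun ⟨e, ⟨_, h1⟩, h2, h3⟩ => ⟨e, h1, h2, h3⟩⟩
  refine (countHat_le_sum_fiber k F).trans ?_
  rw [hc.rank_eq hF, hk, Nat.cast_sum]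
  -- Only nonempty fibres are parts of the partition; the remaining indices contribute nonnegative
  -- dimensions.
  refine (Finset.sum_congr rfl fun q hq => ?_).trans_le
    (Finset.sum_le_univ_sum_of_nonneg (s := F.image k) fun q => Int.natCast_nonneg _)
  obtain ⟨e, he, rfl⟩ := Finset.mem_image.1 hq
  have hne : (F.filter (k · = k e)).Nonempty := ⟨e, Finset.mem_filter.2 ⟨he, rfl⟩⟩
  rw [hfib, ← hc.finrank_blockSpace_eq_count hd hF (Finset.filter_subset _ F) hne]

end Graphs

end BodyRodBar

end

/-- One polynomial serves all `F`: extremality is required for every family of blocks indexed by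
`E`, and edges outside `F` receive the empty block. -/
theorem mainTheorem2 {V E : Type*} [Fintype V] [Fintype E] [DecidableEq E]
    (d : ℕ) (hd : 3 ≤ d) (G : Graph V E) [G.Loopless] (R : Set V) (hR : R ⊆ V(G)) :
    BodyRodBar.RodConfiguration.AlmostAll
      (fun r : BodyRodBar.RodConfiguration d R =>
        ((r.rank G (Set.toFinite E(G)).toFinset : ℤ) =
          BodyRodBar.countHat d G R (Set.toFinite E(G)).toFinset) ∧
        ∀ F : Finset E, (F : Set E) ⊆ E(G) →
          (r.rank G F : ℤ) = BodyRodBar.countHat d G R F) := by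
  classical
  obtain ⟨Q, hQ, hQ'⟩ := BodyRodBar.exists_polynomial_isExtremal (V := V) E hd R
  refine ⟨Q, hQ, fun r c hc hne => ?_⟩
  have key : ∀ F : Finset E, (F : Set E) ⊆ E(G) →
      (r.rank G F : ℤ) = BodyRodBar.countHat d G R F := fun F hF =>
    le_antisymm (hc.rank_le_countHat hd hF) (hc.countHat_le_rank hd (hQ' r c hc hne) hF)
  exact ⟨key _ (by simp), key⟩
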